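/- Let $0<q<1$, let $n\ge 0$, let $\lambda=(\lambda_1\ge\dots\ge\lambda_n\ge0)$ and $\mu=(\mu_1\ge\dots\ge\mu_n\ge0)$ be partitions with at most $n$ parts, and let $\nu$ be the partition obtained from the $n\times n$ square $(n^n)$ by attaching $\lambda$ on the right and the transpose $\mu'$ at the bottom. Let $a$ be a complex number with $\operatorname{Re}(a)>-\lambda_n-\mu_n-1$ (no condition if $n=0$). Let $\mathrm{RPP}(\nu)$ be the set of reverse plane partitions of shape $\nu$, i.e. fillings $T$ of the cells of $\nu$ with non-negative integers that are weakly increasing along rows and columns; $|T|$ is the sum of all entries of $T$, and $\operatorname{tr}(T)$ is the sum of the entries on the main diagonal. Write $(q;q)_m=\prod_{k=1}^m(1-q^k)$, $b(\kappa)=\sum_{i=1}^n(i-1)\kappa_i$, $\delta_{n+1}=(n,n-1,\dots,1)$, $\overline\Delta(x)=\prod_{1\le i<j\le n}(x_j-x_i)$, and let $s_\lambda(x)=\det(x_j^{\lambda_i+n-i})_{i,j=1}^n/\det(x_j^{n-i})_{i,j=1}^n$ be the Schur polynomial (quotient taken in the polynomial ring). For $f$ of one variable let $\int_\alpha^\beta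 f(x)\,d_qx=(1-q)\sum_{i\ge0}\bigl(f(\beta q^i)\beta q^i-f(\alpha q^i)\alpha q^i\bigr)$, and let $$\int_{0\le x_1\le\dots\le x_n\le1}f(x)\,d_qx=\int_0^1\int_0^{x_n}\cdots\int_0^{x_2}f(x_1,\dots,x_n)\,d_qx_1\cdots d_qx_{n-1}\,d_qx_n .$$ Then all the series in the iterated $q$-integral below converge, the sum over $T$ converges absolutely, and $$\sum_{T\in\mathrm{RPP}(\nu)}q^{|T|}(q^a)^{\operatorname{tr}(T)}=\frac{q^{(1-a)\binom n2-b(\delta_{n+1}+\lambda)-b(\delta_{n+1}+\mu)}}{\prod_{j=1}^n(q;q)_{\lambda_j+n-j}\,(q;q)_{\mu_j+n-j}}\cdot\frac1{(1-q)^n}\int_{0\le x_1\le\dots\le x_n\le1}s_\lambda(x)\,s_\mu(x)\prod_{i=1}^nx_i^a\;\overline\Delta(x)^2\,d_qx .$$ -/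

import Mathlib

namespace QSelberg

/-! ## Partitions

A partition `(lam_1, …, lam_n)` with at most `n` parts is an antitone function
`lam : Fin n → ℕ`; the `i`-th part (`1 ≤ i ≤ n`) is the value at the index `i - 1`. -/

/-- The staircase `(n - 1, n - 2, …, 1, 0)`. -/
def staircase (n : ℕ) : Fin n → ℕ := fun i => n - 1 - (i : ℕ)

/-- The staircase `(n, n - 1, …, 1)` (a partition with `n` parts). -/
def bigStaircase (n : ℕ) : Fin n → ℕ := fun i => n - (i : ℕ)

/-- `b(lam) = ∑_{i = 1}^n (i - 1) lam_i`. -/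
def bStat {n : ℕ} (lam : Fin n → ℕ) : ℕ := ∑ i : Fin n, (i : ℕ) * lam i

/-! ## The glued shape and reverse plane partitions -/

/-- The cells `(row, column)`, counted from `0`, of the `n × n` square with `lam` attached on the
right and the transpose of `mu` attached at the bottom. -/
def gluedCells {n : ℕ} (lam mu : Fin n → ℕ) : Finset (ℕ × ℕ) :=
  (Finset.range n ×ˢ Finset.range n) ∪
  ((Finset.univ.biUnion fun i : Fin n =>
      (Finset.range (lam i)).image fun j => ((i : ℕ), n + j)) ∪
   (Finset.univ.biUnion fun j : Fin n =>
      (Finset.range (mu j)).image fun i => (n + i, (j : ℕ))))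

theorem mem_gluedCells {n : ℕ} (lam mu : Fin n → ℕ) (c : ℕ × ℕ) :
    c ∈ gluedCells lam mu ↔
      (∃ h : c.1 < n, c.2 < n + lam ⟨c.1, h⟩) ∨ (∃ h : c.2 < n, c.1 < n + mu ⟨c.2, h⟩) := by
  obtain ⟨r, s⟩ := c
  simp only [gluedCells, Finset.mem_union, Finset.mem_product, Finset.mem_range,
    Finset.mem_biUnion, Finset.mem_univ, true_and, Finset.mem_image, Prod.mk.injEq]
  constructor
  · rintro (⟨h1, h2⟩ | ⟨i, j, hj, rfl, rfl⟩ | ⟨j, i, hi, rfl, rfl⟩)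
    · exact Or.inl ⟨h1, by omega⟩
    · exact Or.inl ⟨i.2, by simpa using hj⟩
    · exact Or.inr ⟨j.2, by simpa using hi⟩
  · rintro (⟨h, hs⟩ | ⟨h, hr⟩)
    · by_cases hsn : s < n
      · exact Or.inl ⟨h, hsn⟩
      · exact Or.inr (Or.inl ⟨⟨r, h⟩, s - n, by omega, rfl, by omega⟩)
    · by_cases hrn : r < n
      · exact Or.inl ⟨hrn, h⟩
      · exact Or.inr (Or.inr ⟨⟨s, h⟩, r - n, by omega, by omega, rfl⟩)

/-- The partition obtained from `(n^n)` by attaching `lam` to the right and the transpose of `mu`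
at the bottom, as a Young diagram. -/
def gluedShape {n : ℕ} (lam mu : Fin n → ℕ) (hlam : Antitone lam) (hmu : Antitone mu) :
    YoungDiagram where
  cells := gluedCells lam mu
  isLowerSet := by
    rintro ⟨r, s⟩ ⟨r', s'⟩ hle hmem
    obtain ⟨hr, hs⟩ : r' ≤ r ∧ s' ≤ s := by simpa using hle
    simp only [Finset.mem_coe, mem_gluedCells] at hmem ⊢
    rcases hmem with ⟨h, hlt⟩ | ⟨h, hlt⟩
    · have hanti : lam ⟨r, h⟩ ≤ lam ⟨r', lt_of_le_of_lt hr h⟩ := hlam (by simpa using hr)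
      exact Or.inl ⟨lt_of_le_of_lt hr h, by omega⟩
    · have hanti : mu ⟨s, h⟩ ≤ mu ⟨s', lt_of_le_of_lt hs h⟩ := hmu (by simpa using hs)
      exact Or.inr ⟨lt_of_le_of_lt hs h, by omega⟩

/-- A reverse plane partition of shape `ν`: a filling of the cells of `ν` with non-negative
integers which is weakly increasing along rows and columns. As for Mathlib's semistandard Young
tableaux, the filling is extended by `0` outside `ν`. -/
structure ReversePlanePartition (ν : YoungDiagram) where
  entry : ℕ → ℕ → ℕ
  row_weak : ∀ {i j1 j2 : ℕ}, j1 < j2 → (i, j2) ∈ ν → entry i j1 ≤ entry i j2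
  col_weak : ∀ {i1 i2 j : ℕ}, i1 < i2 → (i2, j) ∈ ν → entry i1 j ≤ entry i2 j
  zeros : ∀ {i j : ℕ}, (i, j) ∉ ν → entry i j = 0

/-- `|T|`, the sum of all entries of `T`. -/
def ReversePlanePartition.size {ν : YoungDiagram} (T : ReversePlanePartition ν) : ℕ :=
  ∑ c ∈ ν.cells, T.entry c.1 c.2

/-- The trace of `T`, the sum of the entries of `T` on the main diagonal. -/
def ReversePlanePartition.trace {ν : YoungDiagram} (T : ReversePlanePartition ν) : ℕ :=
  ∑ c ∈ ν.cells with c.1 = c.2, T.entry c.1 c.2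

/-! ## Schur polynomials -/

/-- The alternant `det (X_j ^ (e_i))_{i,j}` with integer coefficients. -/
noncomputable def alternant {n : ℕ} (e : Fin n → ℕ) : MvPolynomial (Fin n) ℤ :=
  Matrix.det (Matrix.of fun i j : Fin n => (MvPolynomial.X j : MvPolynomial (Fin n) ℤ) ^ e i)

theorem alternant_staircase (n : ℕ) :
    alternant (staircase n) =
      ∏ i : Fin n, ∏ j ∈ Finset.Ioi i,
        (MvPolynomial.X i - MvPolynomial.X j : MvPolynomial (Fin n) ℤ) := by
  have h := Matrix.det_projVandermonde (fun _ : Fin n => (1 : MvPolynomial (Fin n) ℤ))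
    (fun i => MvPolynomial.X i)
  simp only [one_mul] at h
  rw [← h, alternant, ← Matrix.det_transpose]
  congr 1
  ext1 i j
  simp only [Matrix.transpose_apply, Matrix.of_apply, Matrix.projVandermonde_apply, one_pow,
    one_mul, staircase, Fin.val_rev]
  congr 1
  omega

theorem X_sub_X_dvd_alternant {n : ℕ} (e : Fin n → ℕ) {i j : Fin n} (hij : i ≠ j) :
    (MvPolynomial.X i - MvPolynomial.X j : MvPolynomial (Fin n) ℤ) ∣ alternant e := by
  rw [← Ideal.mem_span_singleton, ← Ideal.Quotient.eq_zero_iff_mem, alternant, RingHom.map_det]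
  refine Matrix.det_zero_of_column_eq hij fun k => ?_
  simp only [RingHom.mapMatrix_apply, Matrix.map_apply, Matrix.of_apply, map_pow]
  congr 1
  rw [Ideal.Quotient.eq]
  exact Ideal.mem_span_singleton_self _

theorem irreducible_X_sub_X {n : ℕ} {i j : Fin n} (hij : i ≠ j) :
    Irreducible (MvPolynomial.X i - MvPolynomial.X j : MvPolynomial (Fin n) ℤ) := by
  have h := MvPolynomial.irreducible_mul_X_add (1 : MvPolynomial (Fin n) ℤ)
    (-MvPolynomial.X j) i one_ne_zero (by simp) (by simp [MvPolynomial.vars_neg, hij])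
    isRelPrime_one_left
  simpa [sub_eq_add_neg] using h

/-- The Vandermonde alternant divides every alternant. -/
theorem alternant_staircase_dvd {n : ℕ} (e : Fin n → ℕ) :
    alternant (staircase n) ∣ alternant e := by
  rw [alternant_staircase, Finset.prod_sigma']
  refine Finset.prod_dvd_of_isRelPrime ?_ ?_
  · rintro ⟨i, j⟩ hij ⟨k, l⟩ hkl hne
    simp only [Finset.coe_sigma, Finset.coe_univ, Set.mem_sigma_iff, Set.mem_univ, true_and,
      Finset.coe_Ioi, Set.mem_Ioi] at hij hkl
    change IsRelPrime _ _
    rw [(irreducible_X_sub_X hij.ne).isRelPrime_iff_not_dvd]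
    rintro ⟨p, hp⟩
    have hne' : ¬ (i = k ∧ j = l) := by
      rintro ⟨rfl, rfl⟩
      exact hne rfl
    have key : ∀ m : Fin n, m ≠ i → m ≠ j → (m = k ∨ m = l) → False := by
      intro m hi hj hm
      have h := congrArg (MvPolynomial.eval fun t : Fin n => if t = m then (1 : ℤ) else 0) hp
      simp only [map_sub, map_mul, MvPolynomial.eval_X, if_neg hi.symm, if_neg hj.symm, sub_self,
        zero_mul] at h
      rcases hm with rfl | rfl
      · simp [hkl.ne'] at h
      · simp [hkl.ne] at h
    by_cases h1 : k ≠ i ∧ k ≠ j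
    · exact key k h1.1 h1.2 (Or.inl rfl)
    · refine key l ?_ ?_ (Or.inr rfl)
      · rintro rfl
        rcases not_and_or.mp h1 with h | h
        · exact hkl.ne (not_not.mp h)
        · have := not_not.mp h
          subst this
          exact absurd hij (not_lt.mpr hkl.le)
      · rintro rfl
        rcases not_and_or.mp h1 with h | h
        · exact hne' ⟨(not_not.mp h).symm, rfl⟩
        · exact hkl.ne (not_not.mp h)
  · rintro ⟨i, j⟩ hij
    simp only [Finset.mem_sigma, Finset.mem_univ, true_and, Finset.mem_Ioi] at hij
    exact X_sub_X_dvd_alternant e hij.ne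

/-- The Schur polynomial `s_lam(X_1, …, X_n)`: the quotient of the alternant with exponents
`lam_i + n - i` by the Vandermonde alternant with exponents `n - i`, in the polynomial ring. -/
noncomputable def schurPoly {n : ℕ} (lam : Fin n → ℕ) : MvPolynomial (Fin n) ℤ :=
  Classical.choose (alternant_staircase_dvd (lam + staircase n))

/-- The property which determines the Schur polynomial. -/
theorem alternant_mul_schurPoly {n : ℕ} (lam : Fin n → ℕ) :
    alternant (staircase n) * schurPoly lam = alternant (lam + staircase n) :=
  (Classical.choose_spec (alternant_staircase_dvd (lam + staircase n))).symm

/-- The value `s_lam(x_1, …, x_n)` of the Schur polynomial at a real point. -/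
noncomputable def schur {n : ℕ} (lam : Fin n → ℕ) (x : Fin n → ℝ) : ℝ :=
  MvPolynomial.aeval x (schurPoly lam)

/-- The Vandermonde product `∏_{i < j} (x_j - x_i)`. -/
noncomputable def vandermondeBar {n : ℕ} (x : Fin n → ℝ) : ℝ :=
  ∏ i : Fin n, ∏ j ∈ Finset.Ioi i, (x j - x i)

/-! ## `q`-analysis -/

/-- `(a; q)_m = (1 - a)(1 - a q) ⋯ (1 - a q^(m - 1))`. -/
noncomputable def qPochhammer (a q : ℝ) (m : ℕ) : ℝ :=
  ∏ k ∈ Finset.range m, (1 - a * q ^ k)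

/-- The `i`-th term of the series defining the `q`-integral of `g` from `a` to `b`. -/
noncomputable def qIntegralTerm (q a b : ℝ) (g : ℝ → ℂ) (i : ℕ) : ℂ :=
  g (b * q ^ i) * ((b * q ^ i : ℝ) : ℂ) - g (a * q ^ i) * ((a * q ^ i : ℝ) : ℂ)

/-- The series defining the `q`-integral of `g` from `a` to `b` converges. -/
def QIntegrable (q a b : ℝ) (g : ℝ → ℂ) : Prop :=
  Summable (qIntegralTerm q a b g)

/-- The `q`-integral of `g` from `a` to `b`:
`(1 - q) ∑_{i ≥ 0} (g(b q^i) b q^i - g(a q^i) a q^i)`. -/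
noncomputable def qIntegral (q a b : ℝ) (g : ℝ → ℂ) : ℂ :=
  (1 - (q : ℂ)) * ∑' i : ℕ, qIntegralTerm q a b g i

/-- The set of values of the last coordinate on `D`. -/
def lastCoords {n : ℕ} (D : Set (Fin (n + 1) → ℝ)) : Set ℝ :=
  (fun y => y (Fin.last n)) '' D

/-- The points `(x_1, …, x_n)` with `(x_1, …, x_n, t) ∈ D`. -/
def slice {n : ℕ} (D : Set (Fin (n + 1) → ℝ)) (t : ℝ) : Set (Fin n → ℝ) :=
  {y | (Fin.snoc y t : Fin (n + 1) → ℝ) ∈ D}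

/-- The multiple `q`-integral `∫_D f(x) d_q x_1 ⋯ d_q x_n` over a (nonempty) convex polytope `D`.
It is iterated: the outermost integration is over `x_n`, from the minimum to the maximum of this
coordinate on `D`; then, for fixed `x_n`, one integrates over `x_{n-1}` between its extreme values
on the points of `D` with that `x_n`, and so on; the innermost integration is over `x_1`. -/
noncomputable def multiQIntegral (q : ℝ) :
    (n : ℕ) → Set (Fin n → ℝ) → ((Fin n → ℝ) → ℂ) → ℂ
  | 0, _, f => f Fin.elim0
  | n + 1, D, f =>
      qIntegral q (sInf (lastCoords D)) (sSup (lastCoords D)) fun t =>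
        multiQIntegral q n (slice D t) fun y => f (Fin.snoc y t)

/-- All the series in the iterated `q`-integral `∫_D f(x) d_q x_1 ⋯ d_q x_n` converge. -/
def MultiQIntegrable (q : ℝ) :
    (n : ℕ) → Set (Fin n → ℝ) → ((Fin n → ℝ) → ℂ) → Prop
  | 0, _, _ => True
  | n + 1, D, f =>
      (∀ i : ℕ, ∀ t : ℝ,
        (t = sInf (lastCoords D) * q ^ i ∨ t = sSup (lastCoords D) * q ^ i) →
          MultiQIntegrable q n (slice D t) fun y => f (Fin.snoc y t)) ∧
      QIntegrable q (sInf (lastCoords D)) (sSup (lastCoords D)) fun t =>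
        multiQIntegral q n (slice D t) fun y => f (Fin.snoc y t)

/-- The simplex `0 ≤ x_1 ≤ x_2 ≤ ⋯ ≤ x_n ≤ 1`. -/
def orderedSimplex (n : ℕ) : Set (Fin n → ℝ) :=
  {x | Monotone x ∧ ∀ i, 0 ≤ x i ∧ x i ≤ 1}

/-- The integrand `s_lam(x) s_mu(x) ∏_i x_i^a ∏_{i < j} (x_j - x_i)^2`. -/
noncomputable def warnaarIntegrand {n : ℕ} (lam mu : Fin n → ℕ) (a : ℂ) (x : Fin n → ℝ) : ℂ :=
  (schur lam x : ℂ) * (schur mu x : ℂ) * (∏ i : Fin n, (x i : ℂ) ^ a) *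
    (vandermondeBar x : ℂ) ^ 2

end QSelberg

namespace QSelberg

/-! ## Summation lemmas -/

theorem hasSum_congr {α M : Type*} [AddCommMonoid M] [TopologicalSpace M] {f g : α → M} {s t : M}
    (h : HasSum f s) (hfg : ∀ x, g x = f x) (hst : t = s) : HasSum g t :=
  hst ▸ h.congr_fun hfg

theorem hasSum_pi_prod {R : Type*} [NormedCommRing R] [CompleteSpace R] {n : ℕ}
    {f : Fin n → ℕ → R} {s : Fin n → R} (hf : ∀ i, HasSum (f i) (s i))
    (hn : ∀ i, Summable fun k => ‖f i k‖) :
    (Summable fun k : Fin n → ℕ => ‖∏ i, f i (k i)‖) ∧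
      HasSum (fun k : Fin n → ℕ => ∏ i, f i (k i)) (∏ i, s i) := by
  induction n with
  | zero =>
    refine ⟨(hasSum_unique _).summable, ?_⟩
    simp
  | succ n ih =>
    obtain ⟨h1, h2⟩ := ih (fun i => hf i.succ) (fun i => hn i.succ)
    set g : (Fin n → ℕ) → R := fun k => ∏ i : Fin n, f i.succ (k i)
    have h3 : Summable fun x : ℕ × (Fin n → ℕ) => ‖f 0 x.1 * g x.2‖ := (hn 0).mul_norm h1
    have h4 : HasSum (fun x : ℕ × (Fin n → ℕ) => f 0 x.1 * g x.2) (s 0 * ∏ i : Fin n, s i.succ) :=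
      (hf 0).mul h2 h3.of_norm
    rw [Fin.prod_univ_succ]
    have key : ∀ x : ℕ × (Fin n → ℕ),
        ∏ i, f i ((Fin.consEquiv fun _ => ℕ) x i) = f 0 x.1 * g x.2 := by
      intro x
      rw [Fin.prod_univ_succ]
      rfl
    constructor
    · refine (Fin.consEquiv fun _ => ℕ).summable_iff.1 (h3.congr fun x => ?_)
      simp only [Function.comp_apply, key]
    · refine (Fin.consEquiv fun _ => ℕ).hasSum_iff.1 (h4.congr_fun fun x => ?_)
      simp only [Function.comp_apply, key]

theorem hasSum_det {R : Type*} [NormedCommRing R] [CompleteSpace R] {n : ℕ}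
    {A : Fin n → Fin n → ℕ → R} {B : Matrix (Fin n) (Fin n) R}
    (hA : ∀ i j, HasSum (A i j) (B i j)) (hn : ∀ i j, Summable fun k => ‖A i j k‖) :
    HasSum (fun k : Fin n → ℕ => (Matrix.of fun i j => A i j (k j)).det) B.det := by
  simp only [Matrix.det_apply', Matrix.of_apply]
  exact hasSum_sum fun σ _ =>
    (hasSum_pi_prod (fun i => hA (σ i) i) fun i => hn (σ i) i).2.mul_left _

theorem hasSum_sigma_of_norm {R : Type*} [NormedAddCommGroup R] [CompleteSpace R] {α : Type*}
    {β : α → Type*} {f : (Σ a, β a) → R} {g : α → R} {N : α → ℝ} {s : R}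
    (hN : ∀ a, HasSum (fun b => ‖f ⟨a, b⟩‖) (N a)) (hNs : Summable N)
    (hg : ∀ a, HasSum (fun b => f ⟨a, b⟩) (g a)) (hs : HasSum g s) : HasSum f s := by
  refine HasSum.sigma_of_hasSum hs hg (Summable.of_norm ?_)
  rw [summable_sigma_of_nonneg fun _ => norm_nonneg _]
  exact ⟨fun a => (hN a).summable, by simpa only [(hN _).tsum_eq] using hNs⟩

theorem hasSum_sigma_of_nonneg {α : Type*} {β : α → Type*} {f : (Σ a, β a) → ℝ} {g : α → ℝ}
    {s : ℝ} (hf : ∀ x, 0 ≤ f x) (hg : ∀ a, HasSum (fun b => f ⟨a, b⟩) (g a)) (hs : HasSum g s) :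
    HasSum f s :=
  hasSum_sigma_of_norm (N := g) (by simpa only [Real.norm_of_nonneg (hf _)] using hg)
    hs.summable hg hs

theorem hasSum_geometric_Ici {r : ℝ} (h0 : 0 ≤ r) (h1 : r < 1) (c : ℕ) :
    HasSum (fun x => if c ≤ x then r ^ x else 0) (r ^ c / (1 - r)) := by
  have h := (hasSum_geometric_of_lt_one h0 h1).mul_left (r ^ c)
  rw [← div_eq_mul_inv] at h
  refine ((add_right_injective c).hasSum_iff ?_).1 (h.congr_fun ?_)
  · intro x hx
    refine if_neg fun hc => hx ⟨x - c, by simp only; omega⟩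
  · intro x
    simp [pow_add]

theorem hasSum_geometric_Ico {r : ℝ} (h0 : 0 ≤ r) (h1 : r < 1) {c C : ℕ} (h : c ≤ C) :
    HasSum (fun x => if c ≤ x ∧ x < C then r ^ x else 0) ((r ^ c - r ^ C) / (1 - r)) := by
  rw [sub_div]
  refine ((hasSum_geometric_Ici h0 h1 c).sub (hasSum_geometric_Ici h0 h1 C)).congr_fun ?_
  intro x
  split_ifs <;> first | omega | simp

/-! ## Fillings of a shifted shape with prescribed main diagonal -/

/-- Fillings of the shifted shape whose row `i` consists of the cells `(i, i), …, (i, i + e i)`,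
weakly increasing along rows and columns, with main diagonal `d`. The value `f i k` is the entry in
the cell `(i, i + k)`. -/
def halfFillings {n : ℕ} (e d : Fin n → ℕ) : Set (Fin n → ℕ → ℕ) :=
  {f | (∀ i k, e i < k → f i k = 0) ∧ (∀ i, f i 0 = d i) ∧
    (∀ i k, k < e i → f i k ≤ f i (k + 1)) ∧
    ∀ i j : Fin n, (j : ℕ) = i + 1 → ∀ k ≤ e j, f i (k + 1) ≤ f j k}

/-- The sum of the entries off the main diagonal. -/
def halfWeight {n : ℕ} (e : Fin n → ℕ) (f : Fin n → ℕ → ℕ) : ℕ :=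
  ∑ i, ∑ k ∈ Finset.range (e i), f i (k + 1)

/-- The condition relating the main diagonal `d` of a filling to the next diagonal `d'`. -/
def Interlaces {n m : ℕ} (hmn : m ≤ n) (d : Fin n → ℕ) (d' : Fin m → ℕ) : Prop :=
  ∀ j : Fin m, d (j.castLE hmn) ≤ d' j ∧ ∀ l : Fin n, (l : ℕ) = j + 1 → d' j ≤ d l

/-- Add the main diagonal `d` to a filling. -/
def consDiag {n m : ℕ} (d : Fin n → ℕ) (f : Fin m → ℕ → ℕ) (i : Fin n) : ℕ → ℕ
  | 0 => d i
  | k + 1 => if h : (i : ℕ) < m then f ⟨i, h⟩ k else 0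

section peel

variable {n m : ℕ} (hmn : m ≤ n) {e d : Fin n → ℕ} {e' : Fin m → ℕ}

@[to_additive]
theorem prod_castLE_of_eq_one {M : Type*} [CommMonoid M] (F : Fin n → M)
    (h : ∀ i : Fin n, m ≤ i → F i = 1) : ∏ i, F i = ∏ i : Fin m, F (i.castLE hmn) := by
  refine (Finset.prod_of_injOn (Fin.castLE hmn) (Fin.castLE_injective hmn).injOn (by simp) ?_
    (by simp)).symm
  intro i _ hi
  refine h i (not_lt.1 fun hlt => hi ⟨⟨i, hlt⟩, by simp, rfl⟩)

theorem halfWeight_consDiag (h1 : ∀ i : Fin m, e (i.castLE hmn) = e' i + 1)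
    (h2 : ∀ i : Fin n, m ≤ i → e i = 0) (f : Fin m → ℕ → ℕ) :
    halfWeight e (consDiag d f) = ∑ i, f i 0 + halfWeight e' f := by
  unfold halfWeight
  rw [sum_castLE_of_eq_zero hmn _ fun i hi => by rw [h2 i hi]; simp, ← Finset.sum_add_distrib]
  refine Finset.sum_congr rfl fun i _ => ?_
  rw [h1, Finset.sum_range_succ', add_comm]
  simp [consDiag]

theorem consDiag_mem (h1 : ∀ i : Fin m, e (i.castLE hmn) = e' i + 1)
    (h2 : ∀ i : Fin n, m ≤ i → e i = 0) {d' : Fin m → ℕ} (hd : Interlaces hmn d d')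
    {f : Fin m → ℕ → ℕ} (hf : f ∈ halfFillings e' d') : consDiag d f ∈ halfFillings e d := by
  obtain ⟨hz, hf0, hr, hc⟩ := hf
  have h1' : ∀ (i : Fin n) (h : (i : ℕ) < m), e i = e' ⟨i, h⟩ + 1 := fun i h => h1 ⟨i, h⟩
  refine ⟨?_, fun i => rfl, ?_, ?_⟩
  · rintro i (_ | k) hk
    · omega
    · simp only [consDiag]
      split_ifs with h
      · exact hz _ _ (by have := h1' i h; omega)
      · rfl
  · rintro i k hk
    have him : (i : ℕ) < m := by
      by_contra h
      rw [h2 i (by omega)] at hk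
      omega
    rcases k with _ | k
    · simp only [consDiag, him, dif_pos, hf0]
      exact (hd ⟨i, him⟩).1
    · simp only [consDiag, him, dif_pos]
      exact hr _ _ (by have := h1' i him; omega)
  · rintro i j hij (_ | k) hk
    · simp only [consDiag]
      split_ifs with h
      · rw [hf0]
        exact (hd ⟨i, h⟩).2 j hij
      · exact Nat.zero_le _
    · have hjm : (j : ℕ) < m := by
        by_contra h
        rw [h2 j (by omega)] at hk
        omega
      have him : (i : ℕ) < m := by omega
      simp only [consDiag, him, hjm, dif_pos]
      exact hc _ _ hij _ (by have := h1' j hjm; omega)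

theorem exists_consDiag_eq (h1 : ∀ i : Fin m, e (i.castLE hmn) = e' i + 1)
    (h2 : ∀ i : Fin n, m ≤ i → e i = 0) {f : Fin n → ℕ → ℕ} (hf : f ∈ halfFillings e d) :
    ∃ d' : Fin m → ℕ, Interlaces hmn d d' ∧ ∃ f' ∈ halfFillings e' d', consDiag d f' = f := by
  obtain ⟨hz, hf0, hr, hc⟩ := hf
  refine ⟨fun i => f (i.castLE hmn) 1, ?_, fun i k => f (i.castLE hmn) (k + 1), ?_, ?_⟩
  · refine fun j => ⟨?_, fun l hl => ?_⟩
    · rw [← hf0]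
      exact hr _ 0 (by rw [h1]; omega)
    · rw [← hf0]
      exact hc _ _ (by simpa using hl) 0 (Nat.zero_le _)
  · refine ⟨fun i k hk => hz _ _ (by rw [h1]; omega), fun i => rfl,
      fun i k hk => hr _ _ (by rw [h1]; omega), fun i j hij k hk => ?_⟩
    exact hc _ _ (by simpa using hij) _ (by rw [h1]; omega)
  · funext i k
    rcases k with _ | k
    · exact (hf0 i).symm
    · simp only [consDiag]
      split_ifs with h
      · rfl
      · exact (hz _ _ (by rw [h2 i (by omega)]; omega)).symm

theorem hasSum_halfFillings_of_interlaces
    (h1 : ∀ i : Fin m, e (i.castLE hmn) = e' i + 1) (h2 : ∀ i : Fin n, m ≤ i → e i = 0)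
    {q : ℝ} (hq : 0 ≤ q) {W : (Fin m → ℕ) → ℝ} {s : ℝ}
    (hW : ∀ d', Interlaces hmn d d' →
      HasSum (fun f : halfFillings e' d' => q ^ halfWeight e' f.1) (W d'))
    (hs : HasSum ({d' | Interlaces hmn d d'}.indicator fun d' => q ^ (∑ i, d' i) * W d') s) :
    HasSum (fun f : halfFillings e d => q ^ halfWeight e f.1) s := by
  let φ : (Σ d' : {d' | Interlaces hmn d d'}, halfFillings e' d'.1) → halfFillings e d :=
    fun x => ⟨consDiag d x.2.1, consDiag_mem hmn h1 h2 x.1.2 x.2.2⟩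
  have hφ : Function.Bijective φ := by
    constructor
    · rintro ⟨⟨d1, hd1⟩, ⟨f1, hf1⟩⟩ ⟨⟨d2, hd2⟩, ⟨f2, hf2⟩⟩ h
      have hff : f1 = f2 := by
        have := congrArg Subtype.val h
        funext i k
        simpa [φ, consDiag] using congrFun (congrFun this (i.castLE hmn)) (k + 1)
      subst hff
      have hdd : d1 = d2 := funext fun i => (hf1.2.1 i).symm.trans (hf2.2.1 i)
      subst hdd
      rfl
    · rintro ⟨f, hf⟩
      obtain ⟨d', hd', f', hf', h⟩ := exists_consDiag_eq hmn h1 h2 hf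
      exact ⟨⟨⟨d', hd'⟩, ⟨f', hf'⟩⟩, Subtype.ext h⟩
  have key : HasSum (fun x : Σ d' : {d' | Interlaces hmn d d'}, halfFillings e' d'.1 =>
      q ^ halfWeight e (consDiag d x.2.1)) s := by
    refine hasSum_sigma_of_nonneg
      (g := fun d' : {d' | Interlaces hmn d d'} => q ^ (∑ i, d'.1 i) * W d'.1)
      (fun x => pow_nonneg hq _) (fun d' => ?_)
      (hasSum_subtype_iff_indicator (f := fun d' => q ^ (∑ i, d' i) * W d').2 hs)
    refine ((hW d'.1 d'.2).mul_left _).congr_fun fun f => ?_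
    simp only
    rw [halfWeight_consDiag hmn h1 h2, pow_add]
    simp only [f.2.2.1]
  exact (Equiv.ofBijective φ hφ).hasSum_iff.1 key

end peel

/-! ## Determinants of column differences -/

theorem det_sub_succ_col {R : Type*} [CommRing R] {n : ℕ} (M : Matrix (Fin n) (Fin n) R) :
    (Matrix.of fun i j : Fin n =>
      M i j - if h : (j : ℕ) + 1 < n then M i ⟨j + 1, h⟩ else 0).det = M.det := by
  let U : Matrix (Fin n) (Fin n) R := Matrix.of fun l j =>
    (if l = j then 1 else 0) - if (l : ℕ) = j + 1 then 1 else 0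
  have hU : U.det = 1 := by
    rw [Matrix.det_of_isLowerTriangular]
    · simp [U]
    · intro i j hij
      have hij' : i < j := hij
      simp only [U, Matrix.of_apply]
      rw [if_neg hij'.ne, if_neg (by rw [Fin.lt_def] at hij'; omega), sub_zero]
  rw [← mul_one M.det, ← hU, ← Matrix.det_mul]
  congr 1
  ext i j
  simp only [U, Matrix.of_apply, Matrix.mul_apply, mul_sub, Finset.sum_sub_distrib, mul_ite,
    mul_one, mul_zero, Finset.sum_ite_eq', Finset.mem_univ, if_true]
  congr 1
  split_ifs with h
  · rw [Finset.sum_eq_single (⟨j + 1, h⟩ : Fin n)]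
    · simp
    · intro b _ hb
      exact if_neg fun hb' => hb (Fin.ext hb')
    · simp
  · exact (Finset.sum_eq_zero fun b _ => if_neg (by omega)).symm

theorem det_sub_succ_col_of_last {R : Type*} [CommRing R] {n : ℕ}
    (M : Matrix (Fin (n + 1)) (Fin (n + 1)) R) (hM : ∀ j, M (Fin.last n) j = 1) :
    (Matrix.of fun i j : Fin n => M i.castSucc j.castSucc - M i.castSucc j.succ).det = M.det := by
  rw [← det_sub_succ_col M, Matrix.det_succ_row _ (Fin.last n), Fin.sum_univ_castSucc,
    Finset.sum_eq_zero, zero_add]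
  · simp only [Fin.val_last, Matrix.of_apply, hM]
    rw [dif_neg (by omega), ← two_mul, pow_mul]
    simp only [sub_zero, mul_one, neg_one_sq, one_pow, one_mul]
    congr 1
    ext i j
    simp only [Matrix.of_apply, Matrix.submatrix_apply, Fin.succAbove_last]
    rw [dif_pos (by simp)]
    rfl
  · intro j _
    simp [hM]

/-! ## The generating function of the fillings of a shifted shape -/

/-- The matrix `(q ^ (e i * k j))`. -/
noncomputable def powMatrix {n : ℕ} (q : ℝ) (e k : Fin n → ℕ) : Matrix (Fin n) (Fin n) ℝ :=
  Matrix.of fun i j => q ^ (e i * k j)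

/-- The diagonal `d` with the staircase `(0, 1, …, n - 1)` added. -/
def addStair {n : ℕ} (d : Fin n → ℕ) : Fin n → ℕ := fun j => d j + j

/-- The generating function of the fillings of a shifted shape with main diagonal `d`. -/
noncomputable def halfGF {n : ℕ} (q : ℝ) (e d : Fin n → ℕ) : ℝ :=
  (powMatrix q e (addStair d)).det * ∏ i : Fin n, (q ^ ((i : ℕ) * e i) * qPochhammer q q (e i))⁻¹

theorem qPochhammer_self_succ (q : ℝ) (m : ℕ) :
    qPochhammer q q (m + 1) = qPochhammer q q m * (1 - q ^ (m + 1)) := by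
  rw [qPochhammer, Finset.prod_range_succ, ← pow_succ', qPochhammer]

section step

variable {n m : ℕ} (hmn : m ≤ n) {e d : Fin n → ℕ} {e' : Fin m → ℕ} {q : ℝ}

theorem hasSum_column (hq0 : 0 < q) (hq1 : q < 1) (hd : Monotone d) (E : ℕ) (j : Fin m) :
    HasSum (fun x : ℕ => if d (j.castLE hmn) ≤ x ∧ ∀ l : Fin n, (l : ℕ) = j + 1 → x ≤ d l then
        q ^ x * q ^ (E * (x + j)) else 0)
      ((q ^ (j : ℕ))⁻¹ * ((1 - q ^ (E + 1))⁻¹ *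
        (q ^ ((E + 1) * addStair d (j.castLE hmn)) -
          if h : (j : ℕ) + 1 < n then q ^ ((E + 1) * addStair d ⟨j + 1, h⟩) else 0))) := by
  have h0 : 0 ≤ q ^ (E + 1) := by positivity
  have h1 : q ^ (E + 1) < 1 := pow_lt_one₀ hq0.le hq1 (by omega)
  have hx : ∀ x : ℕ, q ^ x * q ^ (E * (x + j)) = q ^ (E * (j : ℕ)) * (q ^ (E + 1)) ^ x := by
    intro x
    rw [← pow_mul, ← pow_add, ← pow_add]
    congr 1
    ring
  have hqj : ∀ c : ℕ, (q ^ (j : ℕ))⁻¹ * q ^ ((E + 1) * (c + j)) =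
      q ^ (E * (j : ℕ)) * (q ^ (E + 1)) ^ c := by
    intro c
    rw [inv_mul_eq_iff_eq_mul₀ (by positivity), ← pow_mul, ← pow_add, ← pow_add]
    congr 1
    ring
  split_ifs with h
  · have hle : d (j.castLE hmn) ≤ d ⟨j + 1, h⟩ + 1 :=
      (hd (Fin.le_def.2 (by simp))).trans (Nat.le_succ _)
    refine hasSum_congr ((hasSum_geometric_Ico h0 h1 hle).mul_left (q ^ (E * (j : ℕ))))
      (fun x => ?_) ?_
    ·
      have hiff : (d (j.castLE hmn) ≤ x ∧ ∀ l : Fin n, (l : ℕ) = j + 1 → x ≤ d l) ↔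
          d (j.castLE hmn) ≤ x ∧ x < d ⟨j + 1, h⟩ + 1 := by
        refine and_congr_right fun _ => ⟨fun hl => Nat.lt_succ_of_le (hl _ rfl), fun hl l hlj => ?_⟩
        obtain rfl : l = ⟨j + 1, h⟩ := Fin.ext hlj
        omega
      simp only [hiff, hx, mul_ite, mul_zero]
    · have e1 := hqj (d (j.castLE hmn))
      have e2 := hqj (d ⟨j + 1, h⟩ + 1)
      simp only [addStair, Fin.val_castLE]
      rw [show d ⟨j + 1, h⟩ + ((j : ℕ) + 1) = d ⟨j + 1, h⟩ + 1 + j by ring, div_eq_mul_inv]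
      linear_combination (1 - q ^ (E + 1))⁻¹ * (e1 - e2)
  · refine hasSum_congr ((hasSum_geometric_Ici h0 h1 (d (j.castLE hmn))).mul_left
      (q ^ (E * (j : ℕ)))) (fun x => ?_) ?_
    · have hiff : (d (j.castLE hmn) ≤ x ∧ ∀ l : Fin n, (l : ℕ) = j + 1 → x ≤ d l) ↔
          d (j.castLE hmn) ≤ x :=
        and_iff_left fun l hl => absurd l.2 (by omega)
      simp only [hiff, hx, mul_ite, mul_zero]
    · have e1 := hqj (d (j.castLE hmn))
      simp only [addStair, Fin.val_castLE]
      rw [div_eq_mul_inv]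
      linear_combination (1 - q ^ (E + 1))⁻¹ * e1

theorem hasSum_interlaces (hq0 : 0 < q) (hq1 : q < 1) (hd : Monotone d)
    (h1 : ∀ i : Fin m, e (i.castLE hmn) = e' i + 1) (h2 : ∀ i : Fin n, m ≤ i → e i = 0)
    (hdet : (Matrix.of fun i j : Fin m => powMatrix q e (addStair d) (i.castLE hmn) (j.castLE hmn) -
      if h : (j : ℕ) + 1 < n then powMatrix q e (addStair d) (i.castLE hmn) ⟨j + 1, h⟩ else 0).det =
        (powMatrix q e (addStair d)).det) :
    HasSum ({d' | Interlaces hmn d d'}.indicator fun d' => q ^ (∑ i, d' i) * halfGF q e' d')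
      (halfGF q e d) := by
  have hs := (hasSum_det (fun i j => hasSum_column hmn hq0 hq1 hd (e' i) j)
    fun i j => (hasSum_column hmn hq0 hq1 hd (e' i) j).summable.norm).mul_right
      (∏ i : Fin m, (q ^ ((i : ℕ) * e' i) * qPochhammer q q (e' i))⁻¹)
  refine hasSum_congr hs (fun d' => ?_) ?_
  · classical
    rw [Set.indicator_apply]
    have hA : (Matrix.of fun i j : Fin m =>
        if d (j.castLE hmn) ≤ d' j ∧ ∀ l : Fin n, (l : ℕ) = j + 1 → d' j ≤ d l then
          q ^ d' j * q ^ (e' i * (d' j + j)) else 0) =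
        Matrix.of fun i j : Fin m =>
          (if d (j.castLE hmn) ≤ d' j ∧ ∀ l : Fin n, (l : ℕ) = j + 1 → d' j ≤ d l then
            q ^ d' j else 0) * powMatrix q e' (addStair d') i j := by
      ext i j
      simp only [Matrix.of_apply, powMatrix, addStair, ite_mul, zero_mul]
    rw [hA, Matrix.det_mul_row, Finset.prod_ite_zero]
    simp only [Finset.mem_univ, true_imp_iff]
    by_cases h : ∀ j : Fin m, d (j.castLE hmn) ≤ d' j ∧ ∀ l : Fin n, (l : ℕ) = j + 1 → d' j ≤ d l
    · rw [if_pos (show d' ∈ {d' | Interlaces hmn d d'} from h), if_pos h, halfGF,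
        Finset.prod_pow_eq_pow_sum, mul_assoc]
    · rw [if_neg (show d' ∉ {d' | Interlaces hmn d d'} from h), if_neg h, zero_mul, zero_mul]
  · rw [halfGF, ← hdet, prod_castLE_of_eq_one hmn (M := ℝ) _ fun i hi => by
      rw [h2 i hi]; simp [qPochhammer]]
    have hB : (Matrix.of fun i j : Fin m => (q ^ (j : ℕ))⁻¹ * ((1 - q ^ (e' i + 1))⁻¹ *
        (q ^ ((e' i + 1) * addStair d (j.castLE hmn)) -
          if h : (j : ℕ) + 1 < n then q ^ ((e' i + 1) * addStair d ⟨j + 1, h⟩) else 0))) =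
        Matrix.of fun i j : Fin m => (q ^ (j : ℕ))⁻¹ * (Matrix.of fun i j : Fin m =>
          (1 - q ^ (e' i + 1))⁻¹ * (Matrix.of fun i j : Fin m =>
            powMatrix q e (addStair d) (i.castLE hmn) (j.castLE hmn) -
            if h : (j : ℕ) + 1 < n then powMatrix q e (addStair d) (i.castLE hmn) ⟨j + 1, h⟩
            else 0) i j) i j := by
      ext i j
      simp only [Matrix.of_apply, powMatrix, h1]
    change _ = (Matrix.of fun i j : Fin m => (q ^ (j : ℕ))⁻¹ * ((1 - q ^ (e' i + 1))⁻¹ *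
        (q ^ ((e' i + 1) * addStair d (j.castLE hmn)) -
          if h : (j : ℕ) + 1 < n then q ^ ((e' i + 1) * addStair d ⟨j + 1, h⟩) else 0))).det * _
    rw [hB, Matrix.det_mul_row, Matrix.det_mul_column]
    have hP : ∏ i : Fin m, (q ^ (((i.castLE hmn : Fin n) : ℕ) * e (i.castLE hmn)) *
          qPochhammer q q (e (i.castLE hmn)))⁻¹ =
        (∏ i : Fin m, (q ^ (i : ℕ))⁻¹) * (∏ i : Fin m, (1 - q ^ (e' i + 1))⁻¹) *
          ∏ i : Fin m, (q ^ ((i : ℕ) * e' i) * qPochhammer q q (e' i))⁻¹ := by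
      rw [← Finset.prod_mul_distrib, ← Finset.prod_mul_distrib]
      refine Finset.prod_congr rfl fun i _ => ?_
      rw [← mul_inv, ← mul_inv, h1, qPochhammer_self_succ, Fin.val_castLE, mul_add, pow_add,
        mul_one]
      congr 1
      ring
    rw [hP]
    ring

end step

theorem Interlaces.monotone {n m : ℕ} {hmn : m ≤ n} {d : Fin n → ℕ} {d' : Fin m → ℕ}
    (h : Interlaces hmn d d') : Monotone d' := by
  rcases m with _ | m
  · exact fun i => i.elim0
  · refine Fin.monotone_iff_le_succ.2 fun i => ?_
    exact ((h i.castSucc).2 (i.succ.castLE hmn) (by simp)).trans (h i.succ).1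

theorem hasSum_halfFillings {q : ℝ} (hq0 : 0 < q) (hq1 : q < 1) {n : ℕ} {e d : Fin n → ℕ}
    (he : StrictAnti e) (hd : Monotone d) :
    HasSum (fun f : halfFillings e d => q ^ halfWeight e f.1) (halfGF q e d) := by
  obtain ⟨N, hN⟩ : ∃ N, ∀ i, e i < N :=
    ⟨∑ i, e i + 1, fun i => Nat.lt_succ_of_le
      (Finset.single_le_sum (fun _ _ => Nat.zero_le _) (Finset.mem_univ i))⟩
  induction N generalizing n e d with
  | zero =>
    rcases n with _ | n
    · have : Unique (halfFillings e d) :=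
        { default := ⟨fun i => i.elim0, by simp [halfFillings]⟩
          uniq := fun f => Subtype.ext (funext fun i => i.elim0) }
      convert hasSum_unique fun f : halfFillings e d => q ^ halfWeight e f.1
      simp [halfGF, halfWeight]
    · exact absurd (hN 0) (by simp)
  | succ N ih =>
    by_cases h0 : ∀ i, 1 ≤ e i
    · have h1 : ∀ i : Fin n, e (i.castLE le_rfl) = (e i - 1) + 1 := fun i => by
        have := h0 i
        simp only [Fin.castLE_rfl, id]
        omega
      have h2 : ∀ i : Fin n, n ≤ i → e i = 0 := fun i hi => absurd i.2 (by omega)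
      refine hasSum_halfFillings_of_interlaces le_rfl h1 h2 hq0.le (fun d' hd' => ?_)
        (hasSum_interlaces le_rfl hq0 hq1 hd h1 h2 (det_sub_succ_col _))
      refine ih (fun i j hij => ?_) hd'.monotone fun i => ?_
      · have := he hij
        have := h0 j
        omega
      · have := hN i
        have := h0 i
        omega
    · push Not at h0
      obtain ⟨i0, hi0⟩ := h0
      rcases n with _ | n
      · exact i0.elim0
      have hlast : e (Fin.last n) = 0 := by
        have := he.antitone (Fin.le_last i0)
        omega
      have hpos : ∀ i : Fin n, 0 < e i.castSucc := fun i => by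
        have := he (Fin.castSucc_lt_last i)
        omega
      have h1 : ∀ i : Fin n, e (i.castLE n.le_succ) = (e i.castSucc - 1) + 1 := fun i => by
        have := hpos i
        change e i.castSucc = _
        omega
      have h2 : ∀ i : Fin (n + 1), n ≤ i → e i = 0 := fun i hi => by
        obtain rfl : i = Fin.last n := Fin.ext (by have := i.2; simp; omega)
        exact hlast
      refine hasSum_halfFillings_of_interlaces n.le_succ h1 h2 hq0.le (fun d' hd' => ?_)
        (hasSum_interlaces n.le_succ hq0 hq1 hd h1 h2 ?_)
      · refine ih (fun i j hij => ?_) hd'.monotone fun i => ?_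
        · have := he (Fin.castSucc_lt_castSucc_iff.2 hij)
          have := hpos j
          omega
        · have := hN i.castSucc
          have := hpos i
          omega
      · rw [← det_sub_succ_col_of_last (powMatrix q e (addStair d))
          fun j => by simp [powMatrix, hlast]]
        congr 1
        ext i j
        simp only [Matrix.of_apply]
        rw [dif_pos (by simp)]
        rfl

/-! ## Cutting a reverse plane partition along its main diagonal -/

/-- The sequence `lam_i + n - i`. -/
def shiftedParts {n : ℕ} (lam : Fin n → ℕ) : Fin n → ℕ := lam + staircase n

theorem shiftedParts_strictAnti {n : ℕ} {lam : Fin n → ℕ} (h : Antitone lam) :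
    StrictAnti (shiftedParts lam) := by
  intro i j hij
  have h1 := h hij.le
  have h2 := j.2
  rw [Fin.lt_def] at hij
  simp only [shiftedParts, staircase, Pi.add_apply]
  omega

/-- The filling with diagonal `d`, upper part `f` and lower part `g`. -/
def glue {n : ℕ} (f g : Fin n → ℕ → ℕ) (r c : ℕ) : ℕ :=
  if r ≤ c then if h : r < n then f ⟨r, h⟩ (c - r) else 0
  else if h : c < n then g ⟨c, h⟩ (r - c) else 0

section glue

variable {n : ℕ} {lam mu : Fin n → ℕ} {hlam : Antitone lam} {hmu : Antitone mu}

theorem mem_gluedShape {c : ℕ × ℕ} : c ∈ gluedShape lam mu hlam hmu ↔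
      (∃ h : c.1 < n, c.2 < n + lam ⟨c.1, h⟩) ∨ (∃ h : c.2 < n, c.1 < n + mu ⟨c.2, h⟩) :=
  mem_gluedCells lam mu c

theorem mem_gluedShape_of_le {r k : ℕ} : (r, r + k) ∈ gluedShape lam mu hlam hmu ↔
      ∃ h : r < n, k ≤ shiftedParts lam ⟨r, h⟩ := by
  simp only [mem_gluedShape, shiftedParts, staircase, Pi.add_apply]
  constructor
  · rintro (⟨h, h'⟩ | ⟨h, h'⟩)
    · exact ⟨h, by omega⟩
    · exact ⟨by omega, by omega⟩
  · rintro ⟨h, h'⟩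
    exact Or.inl ⟨h, by omega⟩

theorem mem_gluedShape_of_ge {c k : ℕ} : (c + k, c) ∈ gluedShape lam mu hlam hmu ↔
      ∃ h : c < n, k ≤ shiftedParts mu ⟨c, h⟩ := by
  simp only [mem_gluedShape, shiftedParts, staircase, Pi.add_apply]
  constructor
  · rintro (⟨h, h'⟩ | ⟨h, h'⟩)
    · exact ⟨by omega, by omega⟩
    · exact ⟨h, by omega⟩
  · rintro ⟨h, h'⟩
    exact Or.inr ⟨h, by omega⟩

theorem glue_upper (f g : Fin n → ℕ → ℕ) (i : Fin n) (k : ℕ) : glue f g i (i + k) = f i k := by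
  simp [glue]

theorem glue_lower {f g : Fin n → ℕ → ℕ} (hfg : ∀ i, f i 0 = g i 0) (i : Fin n) (k : ℕ) :
    glue f g (i + k) i = g i k := by
  rcases k with _ | k
  · simp [glue, hfg]
  · simp [glue]

theorem glue_swap {f g : Fin n → ℕ → ℕ} (hfg : ∀ i, f i 0 = g i 0) (r c : ℕ) :
    glue f g r c = glue g f c r := by
  rcases lt_trichotomy r c with h | rfl | h
  · simp [glue, h.le, not_le.2 h]
  · simp [glue, hfg]
  · simp [glue, h.le, not_le.2 h]

theorem glue_eq_zero {d : Fin n → ℕ} {f g : Fin n → ℕ → ℕ}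
    (hf : f ∈ halfFillings (shiftedParts lam) d) (hg : g ∈ halfFillings (shiftedParts mu) d)
    {r c : ℕ} (h : (r, c) ∉ gluedShape lam mu hlam hmu) : glue f g r c = 0 := by
  unfold glue
  split_ifs with h1 h2 h2
  · obtain ⟨k, rfl⟩ := Nat.exists_eq_add_of_le h1
    exact hf.1 _ _ (by rw [Nat.add_sub_cancel_left]; by_contra hk
                       exact h (mem_gluedShape_of_le.2 ⟨h2, not_lt.1 hk⟩))
  · rfl
  · obtain ⟨k, rfl⟩ := Nat.exists_eq_add_of_le (not_le.1 h1).le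
    exact hg.1 _ _ (by rw [Nat.add_sub_cancel_left]; by_contra hk
                       exact h (mem_gluedShape_of_ge.2 ⟨h2, not_lt.1 hk⟩))
  · rfl

theorem glue_row_step {d : Fin n → ℕ} {f g : Fin n → ℕ → ℕ}
    (hf : f ∈ halfFillings (shiftedParts lam) d) (hg : g ∈ halfFillings (shiftedParts mu) d)
    {r c : ℕ} (h : (r, c + 1) ∈ gluedShape lam mu hlam hmu) :
    glue f g r c ≤ glue f g r (c + 1) := by
  have hfg : ∀ i, f i 0 = g i 0 := fun i => (hf.2.1 i).trans (hg.2.1 i).symm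
  by_cases hrc : r ≤ c
  · obtain ⟨k, rfl⟩ := Nat.exists_eq_add_of_le hrc
    obtain ⟨hr, hk⟩ := mem_gluedShape_of_le.1 (show (r, r + (k + 1)) ∈ _ from h)
    have e1 := glue_upper f g ⟨r, hr⟩ k
    have e2 := glue_upper f g ⟨r, hr⟩ (k + 1)
    simp only at e1 e2
    rw [add_assoc, e1, e2]
    exact hf.2.2.1 _ _ hk
  · obtain ⟨k, rfl⟩ := Nat.exists_eq_add_of_le (Nat.succ_le_of_lt (not_le.1 hrc))
    obtain ⟨hc, hk⟩ := mem_gluedShape_of_ge.1 (show (c + 1 + k, c + 1) ∈ _ from h)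
    have e1 := glue_lower hfg ⟨c, by omega⟩ (k + 1)
    have e2 := glue_lower hfg ⟨c + 1, hc⟩ k
    simp only at e1 e2
    rw [Nat.succ_eq_add_one, e2, show c + 1 + k = c + (k + 1) by ring, e1]
    exact hg.2.2.2 _ _ rfl _ hk

theorem glue_row {d : Fin n → ℕ} {f g : Fin n → ℕ → ℕ}
    (hf : f ∈ halfFillings (shiftedParts lam) d) (hg : g ∈ halfFillings (shiftedParts mu) d)
    {r c1 c2 : ℕ} (hc : c1 < c2) (h : (r, c2) ∈ gluedShape lam mu hlam hmu) :
    glue f g r c1 ≤ glue f g r c2 := by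
  induction c2, hc using Nat.le_induction with
  | base => exact glue_row_step hf hg h
  | succ c2 hc ih =>
    exact (ih ((gluedShape lam mu hlam hmu).up_left_mem le_rfl (Nat.le_succ _) h)).trans
      (glue_row_step hf hg h)

theorem mem_gluedShape_swap {r c : ℕ} :
    (r, c) ∈ gluedShape lam mu hlam hmu ↔ (c, r) ∈ gluedShape mu lam hmu hlam := by
  simp only [mem_gluedShape]
  exact or_comm

variable (lam mu hlam hmu) in
/-- The reverse plane partition with diagonal `d`, upper part `f` and lower part `g`. -/
def glueRPP (x : Σ d : Fin n → ℕ, halfFillings (shiftedParts lam) d ×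
    halfFillings (shiftedParts mu) d) : ReversePlanePartition (gluedShape lam mu hlam hmu) where
  entry := glue x.2.1.1 x.2.2.1
  row_weak := fun hj h => glue_row x.2.1.2 x.2.2.2 hj h
  col_weak := fun {i1 i2 j} hi h => by
    have hfg : ∀ i, x.2.1.1 i 0 = x.2.2.1 i 0 :=
      fun i => (x.2.1.2.2.1 i).trans (x.2.2.2.2.1 i).symm
    rw [glue_swap hfg, glue_swap hfg i2]
    exact glue_row x.2.2.2 x.2.1.2 hi (mem_gluedShape_swap.1 h)
  zeros := fun h => glue_eq_zero x.2.1.2 x.2.2.2 h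

theorem ReversePlanePartition.ext' {ν : YoungDiagram}
    {S T : ReversePlanePartition ν} (h : S.entry = T.entry) : S = T := by
  cases S
  cases T
  cases h
  rfl

theorem glueRPP_bijective : Function.Bijective (glueRPP lam mu hlam hmu) := by
  constructor
  · rintro ⟨d1, ⟨f1, hf1⟩, ⟨g1, hg1⟩⟩ ⟨d2, ⟨f2, hf2⟩, ⟨g2, hg2⟩⟩ h
    have hE : glue f1 g1 = glue f2 g2 := congrArg ReversePlanePartition.entry h
    have hf : f1 = f2 := by
      funext i k
      rw [← glue_upper f1 g1, hE, glue_upper]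
    have hg : g1 = g2 := by
      funext i k
      rw [← glue_lower (fun i => (hf1.2.1 i).trans (hg1.2.1 i).symm), hE,
        glue_lower (fun i => (hf2.2.1 i).trans (hg2.2.1 i).symm)]
    subst hf hg
    obtain rfl : d1 = d2 := funext fun i => (hf1.2.1 i).symm.trans (hf2.2.1 i)
    rfl
  · intro T
    refine ⟨⟨fun i => T.entry i i, ⟨fun i k => T.entry i (i + k), ?_⟩,
      ⟨fun i k => T.entry (i + k) i, ?_⟩⟩, ?_⟩
    · refine ⟨fun i k hk => T.zeros fun h => ?_, fun i => rfl,
        fun i k hk => T.row_weak (by omega) (mem_gluedShape_of_le.2 ⟨i.2, hk⟩),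
        fun i j hij k hk => ?_⟩
      · obtain ⟨_, h⟩ := mem_gluedShape_of_le.1 h
        exact absurd hk (not_lt.2 h)
      · simp only
        rw [show (i : ℕ) + (k + 1) = j + k by omega]
        exact T.col_weak (by omega) (mem_gluedShape_of_le.2 ⟨j.2, hk⟩)
    · refine ⟨fun i k hk => T.zeros fun h => ?_, fun i => rfl,
        fun i k hk => T.col_weak (by omega) (mem_gluedShape_of_ge.2 ⟨i.2, hk⟩),
        fun i j hij k hk => ?_⟩
      · obtain ⟨_, h⟩ := mem_gluedShape_of_ge.1 h
        exact absurd hk (not_lt.2 h)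
      · simp only
        rw [show (i : ℕ) + (k + 1) = j + k by omega]
        exact T.row_weak (by omega) (mem_gluedShape_of_ge.2 ⟨j.2, hk⟩)
    · refine ReversePlanePartition.ext' ?_
      funext r c
      simp only [glueRPP, glue]
      split_ifs with h1 h2 h2
      · rw [Nat.add_sub_cancel' h1]
      · obtain ⟨k, rfl⟩ := Nat.exists_eq_add_of_le h1
        exact (T.zeros fun h => h2 (mem_gluedShape_of_le.1 h).1).symm
      · rw [Nat.add_sub_cancel' (not_le.1 h1).le]
      · obtain ⟨k, rfl⟩ := Nat.exists_eq_add_of_le (not_le.1 h1).le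
        exact (T.zeros fun h => h2 (mem_gluedShape_of_ge.1 h).1).symm

theorem sum_diag_cells (F : ℕ → ℕ → ℕ) :
    ∑ c ∈ (gluedShape lam mu hlam hmu).cells with c.1 = c.2, F c.1 c.2 = ∑ i : Fin n, F i i := by
  symm
  refine Finset.sum_bij (fun i _ => ((i : ℕ), (i : ℕ))) (fun i _ => ?_) (fun i _ j _ h => ?_)
    (fun c hc => ?_) (fun i _ => rfl)
  · rw [Finset.mem_filter, YoungDiagram.mem_cells]
    exact ⟨mem_gluedShape_of_le.2 ⟨i.2, Nat.zero_le _⟩, rfl⟩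
  · exact Fin.ext (congrArg Prod.fst h)
  · obtain ⟨r, c⟩ := c
    rw [Finset.mem_filter, YoungDiagram.mem_cells] at hc
    obtain ⟨hc, rfl : r = c⟩ := hc
    obtain ⟨h, _⟩ := mem_gluedShape_of_le.1 (show (r, r + 0) ∈ _ from hc)
    exact ⟨⟨r, h⟩, Finset.mem_univ _, rfl⟩

theorem sum_upper_cells (F : ℕ → ℕ → ℕ) :
    ∑ c ∈ (gluedShape lam mu hlam hmu).cells with c.1 < c.2, F c.1 c.2 =
      ∑ i : Fin n, ∑ k ∈ Finset.range (shiftedParts lam i), F i (i + (k + 1)) := by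
  rw [Finset.sum_sigma']
  symm
  refine Finset.sum_bij (fun x _ => ((x.1 : ℕ), (x.1 : ℕ) + (x.2 + 1))) (fun x hx => ?_)
    (fun x _ y _ h => ?_) (fun c hc => ?_) (fun i _ => rfl)
  · rw [Finset.mem_filter, YoungDiagram.mem_cells]
    simp only [Finset.mem_sigma, Finset.mem_univ, Finset.mem_range, true_and] at hx
    exact ⟨mem_gluedShape_of_le.2 ⟨x.1.2, hx⟩, by simp only; omega⟩
  · obtain ⟨i, k⟩ := x
    obtain ⟨j, l⟩ := y
    simp only [Prod.mk.injEq] at h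
    obtain rfl : i = j := Fin.ext h.1
    obtain rfl : k = l := by omega
    rfl
  · obtain ⟨r, c⟩ := c
    rw [Finset.mem_filter, YoungDiagram.mem_cells] at hc
    obtain ⟨hc, hrc : r < c⟩ := hc
    obtain ⟨k, rfl⟩ := Nat.exists_eq_add_of_lt hrc
    obtain ⟨h, hk⟩ := mem_gluedShape_of_le.1 (show (r, r + (k + 1)) ∈ _ from hc)
    exact ⟨⟨⟨r, h⟩, k⟩, by simpa using hk, rfl⟩

theorem sum_lower_cells (F : ℕ → ℕ → ℕ) :
    ∑ c ∈ (gluedShape lam mu hlam hmu).cells with c.2 < c.1, F c.1 c.2 =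
      ∑ i : Fin n, ∑ k ∈ Finset.range (shiftedParts mu i), F (i + (k + 1)) i := by
  rw [← sum_upper_cells (hlam := hmu) (mu := lam) (hmu := hlam) fun r c => F c r]
  refine Finset.sum_bij (fun c _ => c.swap) (fun c hc => ?_) (fun c _ c' _ h => ?_)
    (fun c hc => ?_) (fun _ _ => rfl)
  · rw [Finset.mem_filter, YoungDiagram.mem_cells] at hc ⊢
    exact ⟨mem_gluedShape_swap.1 hc.1, hc.2⟩
  · exact Prod.swap_injective h
  · rw [Finset.mem_filter, YoungDiagram.mem_cells] at hc
    refine ⟨c.swap, ?_, rfl⟩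
    rw [Finset.mem_filter, YoungDiagram.mem_cells]
    exact ⟨mem_gluedShape_swap.1 hc.1, hc.2⟩

theorem trace_glueRPP (x : Σ d : Fin n → ℕ, halfFillings (shiftedParts lam) d ×
    halfFillings (shiftedParts mu) d) : (glueRPP lam mu hlam hmu x).trace = ∑ i, x.1 i := by
  rw [ReversePlanePartition.trace, sum_diag_cells]
  refine Finset.sum_congr rfl fun i _ => ?_
  exact (glue_upper _ _ i 0).trans (x.2.1.2.2.1 i)

theorem size_glueRPP (x : Σ d : Fin n → ℕ, halfFillings (shiftedParts lam) d ×
    halfFillings (shiftedParts mu) d) : (glueRPP lam mu hlam hmu x).size =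
      ∑ i, x.1 i + halfWeight (shiftedParts lam) x.2.1.1 +
        halfWeight (shiftedParts mu) x.2.2.1 := by
  have hfg : ∀ i, x.2.1.1 i 0 = x.2.2.1 i 0 :=
    fun i => (x.2.1.2.2.1 i).trans (x.2.2.2.2.1 i).symm
  have h1 : ∑ i, x.1 i = ∑ c ∈ (gluedShape lam mu hlam hmu).cells with c.1 = c.2,
      (glueRPP lam mu hlam hmu x).entry c.1 c.2 := (trace_glueRPP x).symm
  have h2 : halfWeight (shiftedParts lam) x.2.1.1 =
      ∑ c ∈ (gluedShape lam mu hlam hmu).cells with c.1 < c.2,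
        (glueRPP lam mu hlam hmu x).entry c.1 c.2 := by
    rw [sum_upper_cells]
    exact Finset.sum_congr rfl fun i _ => Finset.sum_congr rfl fun k _ => (glue_upper _ _ _ _).symm
  have h3 : halfWeight (shiftedParts mu) x.2.2.1 =
      ∑ c ∈ (gluedShape lam mu hlam hmu).cells with c.2 < c.1,
        (glueRPP lam mu hlam hmu x).entry c.1 c.2 := by
    rw [sum_lower_cells]
    exact Finset.sum_congr rfl fun i _ => Finset.sum_congr rfl fun k _ => (glue_lower hfg _ _).symm
  rw [ReversePlanePartition.size, h1, h2, h3, Finset.sum_filter, Finset.sum_filter,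
    Finset.sum_filter, ← Finset.sum_add_distrib, ← Finset.sum_add_distrib]
  refine Finset.sum_congr rfl fun c _ => ?_
  split_ifs <;> omega

end glue

/-! ## The `q`-integral over the ordered simplex as a multiple series -/

/-- The simplex `0 ≤ x_1 ≤ ⋯ ≤ x_n ≤ t`. -/
def simplexUpTo (n : ℕ) (t : ℝ) : Set (Fin n → ℝ) :=
  {x | Monotone x ∧ ∀ i, 0 ≤ x i ∧ x i ≤ t}

theorem lastCoords_simplexUpTo (n : ℕ) {t : ℝ} :
    lastCoords (simplexUpTo (n + 1) t) = Set.Icc 0 t := by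
  ext s
  constructor
  · rintro ⟨x, hx, rfl⟩
    exact hx.2 _
  · intro hs
    exact ⟨fun _ => s, ⟨monotone_const, fun _ => hs⟩, rfl⟩

theorem snoc_monotone_iff {α : Type*} [Preorder α] {n : ℕ} {y : Fin n → α} {s : α} :
    Monotone (Fin.snoc y s : Fin (n + 1) → α) ↔ Monotone y ∧ ∀ i, y i ≤ s := by
  constructor
  · intro h
    refine ⟨fun i j hij => ?_, fun i => ?_⟩
    · simpa using h (Fin.castSucc_le_castSucc_iff.2 hij)
    · simpa using h (Fin.le_last i.castSucc)
  · rintro ⟨h1, h2⟩ i j hij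
    induction j using Fin.lastCases with
    | last =>
      induction i using Fin.lastCases with
      | last => exact le_rfl
      | cast i => simpa using h2 i
    | cast j =>
      induction i using Fin.lastCases with
      | last => exact absurd hij (not_le.2 (Fin.castSucc_lt_last j))
      | cast i => simpa using h1 (Fin.castSucc_le_castSucc_iff.1 hij)

theorem snoc_antitone_iff {n : ℕ} {y : Fin n → ℕ} {s : ℕ} :
    Antitone (Fin.snoc y s : Fin (n + 1) → ℕ) ↔ Antitone y ∧ ∀ i, s ≤ y i :=
  snoc_monotone_iff (α := ℕᵒᵈ)

theorem slice_simplexUpTo {n : ℕ} {s t : ℝ} (h0 : 0 ≤ s) (hst : s ≤ t) :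
    slice (simplexUpTo (n + 1) t) s = simplexUpTo n s := by
  ext y
  change (Monotone (Fin.snoc y s : Fin (n + 1) → ℝ) ∧ _) ↔ _
  rw [snoc_monotone_iff]
  constructor
  · rintro ⟨⟨h1, h2⟩, h3⟩
    exact ⟨h1, fun i => ⟨by simpa using (h3 i.castSucc).1, h2 i⟩⟩
  · rintro ⟨h1, h2⟩
    refine ⟨⟨h1, fun i => (h2 i).2⟩, fun i => ?_⟩
    induction i using Fin.lastCases with
    | last => simpa using ⟨h0, hst⟩
    | cast i => simpa using ⟨(h2 i).1, (h2 i).2.trans hst⟩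

theorem multiQIntegrable_simplexUpTo_zero (q : ℝ) (n : ℕ) (f : (Fin n → ℝ) → ℂ) :
    MultiQIntegrable q n (simplexUpTo n 0) f := by
  induction n with
  | zero => trivial
  | succ n ih =>
    have hI : sInf (lastCoords (simplexUpTo (n + 1) 0)) = 0 := by
      rw [lastCoords_simplexUpTo]
      exact csInf_Icc le_rfl
    have hS : sSup (lastCoords (simplexUpTo (n + 1) 0)) = 0 := by
      rw [lastCoords_simplexUpTo]
      exact csSup_Icc le_rfl
    simp only [MultiQIntegrable, hI, hS, zero_mul, or_self]
    constructor
    · rintro _ t rfl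
      rw [slice_simplexUpTo le_rfl le_rfl]
      exact ih _
    · refine summable_zero.congr fun i => ?_
      simp [qIntegralTerm]

/-- The terms of the multiple series for the `q`-integral of `f`. -/
noncomputable def latticeTerm (q : ℝ) {n : ℕ} (f : (Fin n → ℝ) → ℂ) (k : Fin n → ℕ) : ℂ :=
  f (fun i => q ^ k i) * ∏ i, (q : ℂ) ^ k i

/-- The exponents of the points of the `q`-lattice in the simplex `0 ≤ x_1 ≤ ⋯ ≤ x_n ≤ q ^ m`. -/
def latticeSimplex (n m : ℕ) : Set (Fin n → ℕ) := {k | Antitone k ∧ ∀ i, m ≤ k i}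

theorem snoc_mem_latticeSimplex {n m l : ℕ} {k : Fin n → ℕ} :
    (Fin.snoc k l : Fin (n + 1) → ℕ) ∈ latticeSimplex (n + 1) m ↔
      m ≤ l ∧ k ∈ latticeSimplex n l := by
  change (Antitone (Fin.snoc k l : Fin (n + 1) → ℕ) ∧ _) ↔ _
  rw [snoc_antitone_iff]
  constructor
  · rintro ⟨h1, h2⟩
    exact ⟨by simpa using h2 (Fin.last n), h1⟩
  · rintro ⟨h1, h2⟩
    refine ⟨h2, fun i => ?_⟩
    induction i using Fin.lastCases with
    | last => simpa using h1
    | cast i => simpa using h1.trans (h2.2 i)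

theorem latticeTerm_snoc (q : ℝ) {n : ℕ} (f : (Fin (n + 1) → ℝ) → ℂ) (k : Fin n → ℕ) (l : ℕ) :
    latticeTerm q f (Fin.snoc k l : Fin (n + 1) → ℕ) =
      latticeTerm q (fun y => f (Fin.snoc y (q ^ l))) k * (q : ℂ) ^ l := by
  have h : (fun i => q ^ (Fin.snoc k l : Fin (n + 1) → ℕ) i) =
      (Fin.snoc (fun i => q ^ k i) (q ^ l) : Fin (n + 1) → ℝ) := by
    funext i
    induction i using Fin.lastCases <;> simp
  simp only [latticeTerm, h, Fin.prod_univ_castSucc, Fin.snoc_castSucc, Fin.snoc_last, mul_assoc]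

theorem indicator_latticeTerm_snoc (q : ℝ) {n m : ℕ} (f : (Fin (n + 1) → ℝ) → ℂ) (k : Fin n → ℕ)
    {l : ℕ} (h : m ≤ l) :
    (latticeSimplex (n + 1) m).indicator (latticeTerm q f) (Fin.snoc k l : Fin (n + 1) → ℕ) =
      (latticeSimplex n l).indicator (latticeTerm q fun y => f (Fin.snoc y (q ^ l))) k *
        (q : ℂ) ^ l := by
  by_cases hk : k ∈ latticeSimplex n l
  · rw [Set.indicator_of_mem hk, Set.indicator_of_mem (snoc_mem_latticeSimplex.2 ⟨h, hk⟩),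
      latticeTerm_snoc]
  · rw [Set.indicator_of_notMem hk,
      Set.indicator_of_notMem fun h' => hk (snoc_mem_latticeSimplex.1 h').2, zero_mul]

theorem multiQIntegral_simplexUpTo {q : ℝ} (hq0 : 0 < q) (hq1 : q < 1) {n : ℕ}
    {f : (Fin n → ℝ) → ℂ} {m : ℕ}
    (hf : Summable ((latticeSimplex n m).indicator (latticeTerm q f))) :
    MultiQIntegrable q n (simplexUpTo n (q ^ m)) f ∧
      multiQIntegral q n (simplexUpTo n (q ^ m)) f =
        (1 - (q : ℂ)) ^ n * ∑' k, (latticeSimplex n m).indicator (latticeTerm q f) k := by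
  induction n generalizing m with
  | zero =>
    refine ⟨trivial, ?_⟩
    rw [tsum_eq_single default fun k hk => absurd (Subsingleton.elim _ _) hk,
      Set.indicator_of_mem (show (default : Fin 0 → ℕ) ∈ latticeSimplex 0 m from
        ⟨fun i => i.elim0, fun i => i.elim0⟩)]
    simp only [multiQIntegral, latticeTerm, pow_zero, one_mul, Finset.univ_eq_empty,
      Finset.prod_empty, mul_one]
    congr 1
    exact Subsingleton.elim _ _
  | succ n ih =>
    have hqm : (0 : ℝ) ≤ q ^ m := by positivity
    have hI : sInf (lastCoords (simplexUpTo (n + 1) (q ^ m))) = 0 := by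
      rw [lastCoords_simplexUpTo]
      exact csInf_Icc hqm
    have hS : sSup (lastCoords (simplexUpTo (n + 1) (q ^ m))) = q ^ m := by
      rw [lastCoords_simplexUpTo]
      exact csSup_Icc hqm
    have hqC : (q : ℂ) ≠ 0 := by exact_mod_cast hq0.ne'
    set Φ : ℕ × (Fin n → ℕ) → ℂ := fun x =>
      (latticeSimplex (n + 1) m).indicator (latticeTerm q f)
        (Fin.snoc x.2 x.1 : Fin (n + 1) → ℕ) with hΦ
    have hΦs : Summable Φ := (Fin.snocEquiv fun _ => ℕ).summable_iff.2 hf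
    have hΦt : ∑' k, (latticeSimplex (n + 1) m).indicator (latticeTerm q f) k = ∑' x, Φ x :=
      ((Fin.snocEquiv fun _ => ℕ).tsum_eq _).symm
    have hslice : ∀ i : ℕ, slice (simplexUpTo (n + 1) (q ^ m)) (q ^ m * q ^ i) =
        simplexUpTo n (q ^ (m + i)) := by
      intro i
      rw [slice_simplexUpTo (by positivity) (mul_le_of_le_one_right hqm (pow_le_one₀ hq0.le hq1.le)),
        pow_add]
    have hin : ∀ i : ℕ, Summable ((latticeSimplex n (m + i)).indicator
        (latticeTerm q fun y => f (Fin.snoc y (q ^ (m + i))))) := by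
      intro i
      have h := hΦs.prod_factor (m + i)
      simp only [hΦ, indicator_latticeTerm_snoc q f _ (Nat.le_add_right m i)] at h
      exact (summable_mul_right_iff (pow_ne_zero _ hqC)).1 h
    have hterm : ∀ i : ℕ, qIntegralTerm q 0 (q ^ m) (fun t => multiQIntegral q n
        (slice (simplexUpTo (n + 1) (q ^ m)) t) fun y => f (Fin.snoc y t)) i =
          (1 - (q : ℂ)) ^ n * ∑' k, Φ (m + i, k) := by
      intro i
      simp only [qIntegralTerm, zero_mul, Complex.ofReal_zero, mul_zero, sub_zero, hslice i]
      have h := (ih (hin i)).2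
      rw [← pow_add, h]
      simp only [hΦ, indicator_latticeTerm_snoc q f _ (Nat.le_add_right m i), tsum_mul_right]
      push_cast
      ring
    have hinj : Function.Injective fun i => m + i := add_right_injective m
    have hzero : ∀ l ∉ Set.range fun i => m + i, ∑' k, Φ (l, k) = 0 := by
      intro l hl
      have hlm : ¬ m ≤ l := fun h => hl ⟨l - m, by simp only; omega⟩
      refine (tsum_congr fun k => ?_).trans tsum_zero
      exact Set.indicator_of_notMem (fun h => hlm (snoc_mem_latticeSimplex.1 h).1) _
    have hsum : HasSum (fun i => ∑' k, Φ (m + i, k)) (∑' x, Φ x) :=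
      (hinj.hasSum_iff hzero).2 (hΦs.tsum_prod ▸ hΦs.prod.hasSum)
    have hsum' := (hsum.mul_left ((1 - (q : ℂ)) ^ n)).congr_fun hterm
    simp only [MultiQIntegrable, multiQIntegral, hI, hS, QIntegrable, qIntegral]
    refine ⟨⟨?_, hsum'.summable⟩, ?_⟩
    · rintro i t (rfl | rfl)
      · rw [zero_mul, slice_simplexUpTo le_rfl hqm]
        exact multiQIntegrable_simplexUpTo_zero _ _ _
      · rw [hslice i, ← pow_add]
        exact (ih (hin i)).1
    · rw [hsum'.tsum_eq, hΦt]
      ring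

/-! ## The integrand at the points of the `q`-lattice -/

theorem aeval_alternant {n : ℕ} (e : Fin n → ℕ) (x : Fin n → ℝ) :
    MvPolynomial.aeval x (alternant e) = (Matrix.of fun i j : Fin n => x j ^ e i).det := by
  rw [alternant, AlgHom.map_det]
  congr 1
  ext i j
  simp

theorem aeval_alternant_staircase_sq {n : ℕ} (x : Fin n → ℝ) :
    MvPolynomial.aeval x (alternant (staircase n)) ^ 2 = vandermondeBar x ^ 2 := by
  rw [alternant_staircase, vandermondeBar]
  simp only [map_prod, map_sub, MvPolynomial.aeval_X, ← Finset.prod_pow]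
  exact Finset.prod_congr rfl fun i _ => Finset.prod_congr rfl fun j _ => by ring

theorem schur_mul_schur_mul_vandermondeBar_sq {n : ℕ} (lam mu : Fin n → ℕ) (x : Fin n → ℝ) :
    schur lam x * schur mu x * vandermondeBar x ^ 2 =
      (Matrix.of fun i j : Fin n => x j ^ shiftedParts lam i).det *
        (Matrix.of fun i j : Fin n => x j ^ shiftedParts mu i).det := by
  rw [← aeval_alternant, ← aeval_alternant, shiftedParts, shiftedParts, ← alternant_mul_schurPoly,
    ← alternant_mul_schurPoly, map_mul, map_mul, ← aeval_alternant_staircase_sq, schur, schur]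
  ring

theorem cpow_ofReal_pow {q : ℝ} (hq : 0 ≤ q) (a : ℂ) (k : ℕ) :
    ((q ^ k : ℝ) : ℂ) ^ a = ((q : ℂ) ^ a) ^ k := by
  induction k with
  | zero => simp
  | succ k ih =>
    rw [pow_succ, Complex.ofReal_mul, Complex.mul_cpow_ofReal_nonneg (by positivity) hq, ih,
      pow_succ]

theorem latticeTerm_warnaarIntegrand {q : ℝ} (hq : 0 ≤ q) {n : ℕ} (lam mu : Fin n → ℕ) (a : ℂ)
    (k : Fin n → ℕ) :
    latticeTerm q (warnaarIntegrand lam mu a) k =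
      (((powMatrix q (shiftedParts lam) k).det * (powMatrix q (shiftedParts mu) k).det : ℝ) : ℂ) *
        ((q : ℂ) ^ a * q) ^ ∑ i, k i := by
  have hP : ∀ e : Fin n → ℕ, powMatrix q e k = Matrix.of fun i j : Fin n => (q ^ k j) ^ e i := by
    intro e
    ext i j
    simp only [powMatrix, Matrix.of_apply, ← pow_mul, mul_comm]
  rw [hP, hP, ← schur_mul_schur_mul_vandermondeBar_sq, latticeTerm, warnaarIntegrand,
    ← Finset.prod_pow_eq_pow_sum]
  simp only [cpow_ofReal_pow hq, mul_pow, Finset.prod_mul_distrib]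
  push_cast
  ring

theorem summable_latticeTerm {q : ℝ} (hq0 : 0 < q) (hq1 : q < 1) {n : ℕ} {lam mu : Fin n → ℕ}
    (hlam : Antitone lam) (hmu : Antitone mu) {a : ℂ}
    (ha : ∀ i : Fin n, -((lam i : ℝ) + (mu i : ℝ)) - 1 < a.re) :
    Summable (latticeTerm q (warnaarIntegrand lam mu a)) := by
  set Q : ℂ := (q : ℂ) ^ a * q with hQ
  have hr : ∀ i j : Fin n, ‖(q : ℂ) ^ (shiftedParts lam i + shiftedParts mu j) * Q‖ < 1 := by
    intro i j
    have hpos : 0 < ((shiftedParts lam i + shiftedParts mu j : ℕ) : ℝ) + (a.re + 1) := by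
      have h := ha (max i j)
      have h1 : lam (max i j) ≤ shiftedParts lam i :=
        (hlam (le_max_left i j)).trans (Nat.le_add_right _ _)
      have h2 : mu (max i j) ≤ shiftedParts mu j :=
        (hmu (le_max_right i j)).trans (Nat.le_add_right _ _)
      have h1' : (lam (max i j) : ℝ) ≤ shiftedParts lam i := by exact_mod_cast h1
      have h2' : (mu (max i j) : ℝ) ≤ shiftedParts mu j := by exact_mod_cast h2
      push_cast
      linarith
    rw [norm_mul, norm_pow, hQ, norm_mul, Complex.norm_cpow_eq_rpow_re_of_pos hq0,
      Complex.norm_real, Real.norm_of_nonneg hq0.le, ← Real.rpow_natCast,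
      ← Real.rpow_add_one hq0.ne', ← Real.rpow_add hq0]
    exact Real.rpow_lt_one hq0.le hq1 hpos
  have hexp : ∀ k : Fin n → ℕ, latticeTerm q (warnaarIntegrand lam mu a) k =
      ∑ σ : Equiv.Perm (Fin n), ∑ τ : Equiv.Perm (Fin n),
        (((Equiv.Perm.sign σ : ℤ) : ℂ) * ((Equiv.Perm.sign τ : ℤ) : ℂ)) *
          ∏ i, ((q : ℂ) ^ (shiftedParts lam (σ i) + shiftedParts mu (τ i)) * Q) ^ k i := by
    intro k
    rw [latticeTerm_warnaarIntegrand hq0.le, Matrix.det_apply', Matrix.det_apply',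
      Finset.sum_mul_sum, Complex.ofReal_sum, Finset.sum_mul]
    refine Finset.sum_congr rfl fun σ _ => ?_
    rw [Complex.ofReal_sum, Finset.sum_mul]
    refine Finset.sum_congr rfl fun τ _ => ?_
    rw [← hQ, ← Finset.prod_pow_eq_pow_sum]
    simp only [powMatrix, Matrix.of_apply, mul_pow, pow_add, Finset.prod_mul_distrib, ← pow_mul]
    push_cast
    ring
  rw [funext hexp]
  refine summable_sum fun σ _ => summable_sum fun τ _ => Summable.mul_left _ ?_
  refine (hasSum_pi_prod (fun i => (summable_geometric_of_norm_lt_one (hr (σ i) (τ i))).hasSum)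
    fun i => ?_).2.summable
  simpa only [norm_pow] using summable_geometric_of_lt_one (norm_nonneg _) (hr (σ i) (τ i))

/-! ## Reindexing by diagonals -/

/-- The strictly decreasing sequence attached to a diagonal. -/
def revStair {n : ℕ} (d : Fin n → ℕ) : Fin n → ℕ := fun j => addStair d j.rev

theorem addStair_strictMono_iff {n : ℕ} {d : Fin n → ℕ} :
    StrictMono (addStair d) ↔ Monotone d := by
  rcases n with _ | n
  · exact ⟨fun _ i => i.elim0, fun _ i => i.elim0⟩
  · rw [Fin.strictMono_iff_lt_succ, Fin.monotone_iff_le_succ]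
    refine forall_congr' fun i => ?_
    simp only [addStair, Fin.val_castSucc, Fin.val_succ]
    omega

theorem revStair_strictAnti_iff {n : ℕ} {d : Fin n → ℕ} :
    StrictAnti (revStair d) ↔ Monotone d := by
  rw [← addStair_strictMono_iff]
  constructor
  · intro h i j hij
    simpa [revStair] using h (Fin.rev_lt_rev.2 hij)
  · exact fun h i j hij => h (Fin.rev_lt_rev.2 hij)

theorem revStair_injective {n : ℕ} : Function.Injective (revStair (n := n)) := by
  intro d d' h
  funext j
  have := congrFun h j.rev
  simpa [revStair, addStair] using this

theorem le_of_strictMono_fin {n : ℕ} {f : Fin n → ℕ} (hf : StrictMono f) (i : Fin n) :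
    (i : ℕ) ≤ f i := by
  obtain ⟨i, hi⟩ := i
  induction i with
  | zero => exact Nat.zero_le _
  | succ i ih =>
    exact Nat.succ_le_of_lt ((ih (by omega)).trans_lt (hf (Fin.mk_lt_mk.2 (Nat.lt_succ_self i))))

theorem exists_revStair_eq {n : ℕ} {k : Fin n → ℕ} (hk : StrictAnti k) : ∃ d, revStair d = k := by
  have hm : StrictMono fun i : Fin n => k i.rev := fun i j hij => hk (Fin.rev_lt_rev.2 hij)
  refine ⟨fun j => k j.rev - j, ?_⟩
  funext j
  have := le_of_strictMono_fin hm j.rev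
  simp only [Fin.rev_rev] at this
  simp only [revStair, addStair, Fin.rev_rev]
  omega

theorem det_powMatrix_revStair (q : ℝ) {n : ℕ} (e d : Fin n → ℕ) :
    (powMatrix q e (revStair d)).det =
      ((Equiv.Perm.sign (Fin.revPerm (n := n)) : ℤ) : ℝ) * (powMatrix q e (addStair d)).det :=
  Matrix.det_permute' Fin.revPerm (powMatrix q e (addStair d))

theorem det_powMatrix_eq_zero (q : ℝ) {n : ℕ} (e : Fin n → ℕ) {k : Fin n → ℕ} (hk : Antitone k)
    (hk' : ¬ StrictAnti k) : (powMatrix q e k).det = 0 := by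
  have hinj : ¬ Function.Injective k := fun h => hk' (hk.strictAnti_of_injective h)
  simp only [Function.Injective, not_forall] at hinj
  obtain ⟨i, j, hij, hne⟩ := hinj
  exact Matrix.det_zero_of_column_eq hne fun l => by simp [powMatrix, hij]

theorem sum_addStair {n : ℕ} (d : Fin n → ℕ) : ∑ i, addStair d i = ∑ i, d i + n.choose 2 := by
  simp only [addStair, Finset.sum_add_distrib]
  rw [Fin.sum_univ_eq_sum_range fun i => i, Finset.sum_range_id, Nat.choose_two_right]

theorem hasSum_diagonals {q : ℝ} (hq0 : 0 < q) {n : ℕ} {lam mu : Fin n → ℕ} {a : ℂ} {s : ℂ}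
    (hs : HasSum ((latticeSimplex n 0).indicator (latticeTerm q (warnaarIntegrand lam mu a))) s) :
    HasSum ({d : Fin n → ℕ | Monotone d}.indicator fun d =>
      (((powMatrix q (shiftedParts lam) (addStair d)).det *
        (powMatrix q (shiftedParts mu) (addStair d)).det : ℝ) : ℂ) *
        ((q : ℂ) ^ a * q) ^ ∑ i, d i) (s * (((q : ℂ) ^ a * q) ^ n.choose 2)⁻¹) := by
  have hQ : (q : ℂ) ^ a * q ≠ 0 := by
    have hqC : (q : ℂ) ≠ 0 := by exact_mod_cast hq0.ne'
    exact mul_ne_zero (by simp [Complex.cpow_eq_zero_iff, hqC]) hqC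
  have hstrict : (latticeSimplex n 0).indicator (latticeTerm q (warnaarIntegrand lam mu a)) =
      {k : Fin n → ℕ | StrictAnti k}.indicator (latticeTerm q (warnaarIntegrand lam mu a)) := by
    funext k
    by_cases h1 : StrictAnti k
    · rw [Set.indicator_of_mem (show k ∈ latticeSimplex n 0 from
          ⟨h1.antitone, fun _ => Nat.zero_le _⟩),
        Set.indicator_of_mem (show k ∈ {k : Fin n → ℕ | StrictAnti k} from h1)]
    · rw [Set.indicator_of_notMem (show k ∉ {k : Fin n → ℕ | StrictAnti k} from h1)]
      by_cases h2 : k ∈ latticeSimplex n 0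
      · rw [Set.indicator_of_mem h2, latticeTerm_warnaarIntegrand hq0.le,
          det_powMatrix_eq_zero q _ h2.1 h1]
        simp
      · rw [Set.indicator_of_notMem h2]
  rw [hstrict] at hs
  have h := ((revStair_injective (n := n)).hasSum_iff fun k hk => Set.indicator_of_notMem
    (fun h : StrictAnti k => hk (exists_revStair_eq h)) _).2 hs
  refine (h.mul_right _).congr_fun fun d => ?_
  rw [Function.comp_apply]
  by_cases hd : Monotone d
  · rw [Set.indicator_of_mem (show d ∈ {d : Fin n → ℕ | Monotone d} from hd),
      Set.indicator_of_mem (show revStair d ∈ {k : Fin n → ℕ | StrictAnti k} from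
        revStair_strictAnti_iff.2 hd), latticeTerm_warnaarIntegrand hq0.le,
      det_powMatrix_revStair, det_powMatrix_revStair]
    have hsum : ∑ i, revStair d i = ∑ i, d i + n.choose 2 := by
      rw [← sum_addStair]
      exact Equiv.sum_comp Fin.revPerm (addStair d)
    have hsign : ((Equiv.Perm.sign (Fin.revPerm (n := n)) : ℤ) : ℝ) *
        ((Equiv.Perm.sign (Fin.revPerm (n := n)) : ℤ) : ℝ) = 1 := by
      rw [← Int.cast_mul, ← Units.val_mul, Int.units_mul_self]
      simp
    rw [hsum, pow_add, mul_mul_mul_comm, hsign, one_mul]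
    field_simp
  · rw [Set.indicator_of_notMem (show d ∉ {d : Fin n → ℕ | Monotone d} from hd),
      Set.indicator_of_notMem (show revStair d ∉ {k : Fin n → ℕ | StrictAnti k} from
        fun h => hd (revStair_strictAnti_iff.1 h)), zero_mul]

/-! ## Summation over reverse plane partitions -/

theorem monotone_of_mem_halfFillings {n : ℕ} {e d : Fin n → ℕ} (he : StrictAnti e)
    {f : Fin n → ℕ → ℕ} (hf : f ∈ halfFillings e d) : Monotone d := by
  rcases n with _ | n
  · exact fun i => i.elim0
  · refine Fin.monotone_iff_le_succ.2 fun i => ?_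
    rw [← hf.2.1, ← hf.2.1]
    exact (hf.2.2.1 _ _ ((Nat.zero_le _).trans_lt (he i.castSucc_lt_succ))).trans
      (hf.2.2.2 _ _ (by simp) 0 (Nat.zero_le _))

theorem hasSum_prod_mul {α β : Type*} {f : α → ℝ} {g : β → ℝ} {s t : ℝ} (hf : HasSum f s)
    (hg : HasSum g t) : HasSum (fun x : α × β => f x.1 * g x.2) (s * t) :=
  hf.mul hg (summable_mul_of_summable_norm hf.summable.norm hg.summable.norm)

theorem hasSum_reversePlanePartition {q : ℝ} (hq0 : 0 < q) (hq1 : q < 1) {n : ℕ}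
    {lam mu : Fin n → ℕ} (hlam : Antitone lam) (hmu : Antitone mu) {w s : ℂ}
    (hs : HasSum ({d : Fin n → ℕ | Monotone d}.indicator fun d =>
      ((halfGF q (shiftedParts lam) d * halfGF q (shiftedParts mu) d : ℝ) : ℂ) *
        (w * q) ^ ∑ i, d i) s) :
    HasSum (fun T : ReversePlanePartition (gluedShape lam mu hlam hmu) =>
      (q : ℂ) ^ T.size * w ^ T.trace) s := by
  have hreal : ∀ d : Fin n → ℕ, Monotone d →
      HasSum (fun x : halfFillings (shiftedParts lam) d × halfFillings (shiftedParts mu) d =>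
        q ^ halfWeight (shiftedParts lam) x.1.1 * q ^ halfWeight (shiftedParts mu) x.2.1)
        (halfGF q (shiftedParts lam) d * halfGF q (shiftedParts mu) d) := by
    intro d hd
    have h1 := hasSum_halfFillings hq0 hq1 (shiftedParts_strictAnti hlam) hd
    have h2 := hasSum_halfFillings hq0 hq1 (shiftedParts_strictAnti hmu) hd
    have h3 := hasSum_prod_mul h1 h2
    exact h3
  have hterm : ∀ (d : Fin n → ℕ)
      (x : halfFillings (shiftedParts lam) d × halfFillings (shiftedParts mu) d),
      (q : ℂ) ^ (glueRPP lam mu hlam hmu ⟨d, x⟩).size *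
          w ^ (glueRPP lam mu hlam hmu ⟨d, x⟩).trace =
        ((q ^ halfWeight (shiftedParts lam) x.1.1 *
          q ^ halfWeight (shiftedParts mu) x.2.1 : ℝ) : ℂ) * (w * q) ^ ∑ i, d i := by
    intro d x
    rw [size_glueRPP, trace_glueRPP, mul_pow, pow_add, pow_add]
    push_cast
    ring
  have hempty : ∀ d : Fin n → ℕ, ¬ Monotone d →
      IsEmpty (halfFillings (shiftedParts lam) d × halfFillings (shiftedParts mu) d) :=
    fun d hd => ⟨fun x => hd
      (monotone_of_mem_halfFillings (shiftedParts_strictAnti hlam) x.1.2)⟩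
  have key : HasSum (fun x : Σ d : Fin n → ℕ, halfFillings (shiftedParts lam) d ×
      halfFillings (shiftedParts mu) d => (q : ℂ) ^ (glueRPP lam mu hlam hmu x).size *
        w ^ (glueRPP lam mu hlam hmu x).trace) s := by
    refine hasSum_sigma_of_norm (fun d => ?_) hs.summable.norm (fun d => ?_) hs
    · simp only [hterm]
      by_cases hd : Monotone d
      · rw [Set.indicator_of_mem (show d ∈ {d : Fin n → ℕ | Monotone d} from hd), norm_mul,
          Complex.norm_real, Real.norm_of_nonneg ((hreal d hd).nonneg fun _ => by positivity)]
        refine ((hreal d hd).mul_right _).congr_fun fun x => ?_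
        rw [norm_mul, Complex.norm_real, Real.norm_of_nonneg (by positivity)]
      · have := hempty d hd
        rw [Set.indicator_of_notMem (show d ∉ {d : Fin n → ℕ | Monotone d} from hd), norm_zero]
        exact hasSum_empty
    · simp only [hterm]
      by_cases hd : Monotone d
      · rw [Set.indicator_of_mem (show d ∈ {d : Fin n → ℕ | Monotone d} from hd)]
        exact (Complex.hasSum_ofReal.2 (hreal d hd)).mul_right _
      · have := hempty d hd
        rw [Set.indicator_of_notMem (show d ∉ {d : Fin n → ℕ | Monotone d} from hd)]
        exact hasSum_empty
  exact (Equiv.ofBijective _ (glueRPP_bijective (hlam := hlam) (hmu := hmu))).hasSum_iff.1 key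

/-! ## The constant -/

theorem bStat_bigStaircase_add {n : ℕ} (lam : Fin n → ℕ) :
    bStat (bigStaircase n + lam) = ∑ i : Fin n, (i : ℕ) * shiftedParts lam i + n.choose 2 := by
  have h : n.choose 2 = ∑ i : Fin n, (i : ℕ) := by
    rw [Fin.sum_univ_eq_sum_range fun i => i, Finset.sum_range_id, Nat.choose_two_right]
  rw [bStat, h, ← Finset.sum_add_distrib]
  refine Finset.sum_congr rfl fun i _ => ?_
  rw [show (bigStaircase n + lam) i = shiftedParts lam i + 1 by
    have := i.2
    simp only [bigStaircase, shiftedParts, staircase, Pi.add_apply]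
    omega]
  ring

theorem prod_inv_pow_mul_qPochhammer (q : ℝ) {n : ℕ} (e : Fin n → ℕ) :
    ∏ i : Fin n, (q ^ ((i : ℕ) * e i) * qPochhammer q q (e i))⁻¹ =
      (q ^ ∑ i : Fin n, (i : ℕ) * e i)⁻¹ * (∏ i, qPochhammer q q (e i))⁻¹ := by
  rw [← Finset.prod_pow_eq_pow_sum, ← mul_inv, ← Finset.prod_mul_distrib, Finset.prod_inv_distrib]

theorem cpow_constant {q : ℝ} (hq0 : 0 < q) (a : ℂ) (N A B : ℕ) :
    (q : ℂ) ^ ((1 - a) * (N : ℂ) - ((A + N : ℕ) : ℂ) - ((B + N : ℕ) : ℂ)) =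
      ((q : ℂ) ^ A)⁻¹ * ((q : ℂ) ^ B)⁻¹ * (((q : ℂ) ^ a * q) ^ N)⁻¹ := by
  have hqC : (q : ℂ) ≠ 0 := by exact_mod_cast hq0.ne'
  rw [show (1 - a) * (N : ℂ) - ((A + N : ℕ) : ℂ) - ((B + N : ℕ) : ℂ) =
    -((A : ℂ) + (B : ℂ) + ((N : ℂ) * a + N)) by push_cast; ring, Complex.cpow_neg,
    Complex.cpow_add _ _ hqC, Complex.cpow_add _ _ hqC, Complex.cpow_add _ _ hqC,
    Complex.cpow_nat_mul, Complex.cpow_natCast, Complex.cpow_natCast, Complex.cpow_natCast,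
    ← mul_pow, mul_inv, mul_inv]

theorem orderedSimplex_eq (q : ℝ) (n : ℕ) : orderedSimplex n = simplexUpTo n (q ^ 0) := by
  rw [pow_zero]
  rfl

end QSelberg

theorem theorem7p7 (n : ℕ) (lam mu : Fin n → ℕ) (hlam : Antitone lam) (hmu : Antitone mu)
    (q : ℝ) (hq0 : 0 < q) (hq1 : q < 1)
    (a : ℂ) (ha : ∀ i : Fin n, -((lam i : ℝ) + (mu i : ℝ)) - 1 < a.re) :
    QSelberg.MultiQIntegrable q n (QSelberg.orderedSimplex n)
      (QSelberg.warnaarIntegrand lam mu a) ∧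
    HasSum
      (fun T : QSelberg.ReversePlanePartition (QSelberg.gluedShape lam mu hlam hmu) =>
        (q : ℂ) ^ T.size * ((q : ℂ) ^ a) ^ T.trace)
      ((q : ℂ) ^ ((1 - a) * ((n.choose 2 : ℕ) : ℂ)
            - ((QSelberg.bStat (QSelberg.bigStaircase n + lam) : ℕ) : ℂ)
            - ((QSelberg.bStat (QSelberg.bigStaircase n + mu) : ℕ) : ℂ))
        / (((∏ j : Fin n,
              QSelberg.qPochhammer q q (lam j + QSelberg.staircase n j) *
              QSelberg.qPochhammer q q (mu j + QSelberg.staircase n j) : ℝ)) : ℂ)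
        * (1 / (1 - (q : ℂ)) ^ n)
        * QSelberg.multiQIntegral q n (QSelberg.orderedSimplex n)
            (QSelberg.warnaarIntegrand lam mu a)) := by
  have hS : Summable ((QSelberg.latticeSimplex n 0).indicator
      (QSelberg.latticeTerm q (QSelberg.warnaarIntegrand lam mu a))) :=
    (QSelberg.summable_latticeTerm hq0 hq1 hlam hmu ha).indicator _
  obtain ⟨hint, hval⟩ := QSelberg.multiQIntegral_simplexUpTo hq0 hq1 hS
  rw [QSelberg.orderedSimplex_eq q n]
  refine ⟨hint, QSelberg.hasSum_reversePlanePartition hq0 hq1 hlam hmu ?_⟩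
  refine QSelberg.hasSum_congr ((QSelberg.hasSum_diagonals hq0 hS.hasSum).mul_left
    (((∏ i : Fin n, (q ^ ((i : ℕ) * QSelberg.shiftedParts lam i) *
        QSelberg.qPochhammer q q (QSelberg.shiftedParts lam i))⁻¹) *
      ∏ i : Fin n, (q ^ ((i : ℕ) * QSelberg.shiftedParts mu i) *
        QSelberg.qPochhammer q q (QSelberg.shiftedParts mu i))⁻¹ : ℝ) : ℂ)) (fun d => ?_) ?_
  · rw [← Set.indicator_const_mul]
    refine congrFun (congrArg _ (funext fun d => ?_)) d
    simp only [QSelberg.halfGF]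
    push_cast
    ring
  · have hq1C : (1 - (q : ℂ)) ^ n ≠ 0 :=
      pow_ne_zero _ (sub_ne_zero.2 (by exact_mod_cast hq1.ne'))
    rw [hval, QSelberg.bStat_bigStaircase_add, QSelberg.bStat_bigStaircase_add,
      QSelberg.cpow_constant hq0, QSelberg.prod_inv_pow_mul_qPochhammer,
      QSelberg.prod_inv_pow_mul_qPochhammer, Finset.prod_mul_distrib, div_eq_mul_inv, one_div,
      ← mul_assoc, mul_assoc _ _ ((1 - (q : ℂ)) ^ n), inv_mul_cancel₀ hq1C]
    simp only [QSelberg.shiftedParts, Pi.add_apply]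
    push_cast
    rw [mul_inv]
    ring
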